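/- \textbf{Definitions.} A \emph{set sequence equipped with embeddings} (ssee) $\mathbf V$ is a sequence $(V_n)_{n\in\mathbb N}$ of finite sets together with, for every $N\le n$, a collection $\binom{V_n}{V_N}$ of injections $\phi:V_N\to V_n$ (called embeddings). Let $I(N,n)$ be the number of pairs $(\phi_1,\phi_2)$ of embeddings of $V_N$ into $V_n$ with $1<|\phi_1(V_N)\cap\phi_2(V_N)|<|V_N|$. The ssee is \emph{good} if $|V_n|\to\infty$ and, for every $N$ with $|V_N|>1$, \[\left|\tbinom{V_n}{V_N}\right|\Big/|V_n|\to\infty\quad\text{and}\quad |V_n|\,I(N,n)\Big/\left|\tbinom{V_n}{V_N}\right|^2\to 0\qquad(n\to\infty).\] For a finite set $V$, let $\mathrm{vol}$ be Lebesgue measure on $[0,1]^V$. A \emph{box} in $[0,1]^V$ is a product $\prod_{i\in V}A_i$ of measurable sets $A_i\subseteq[0,1]$. The \emph{entropy} of a measurable set $b\subseteq[0,1]^V$ is $\mathrm{Ent}(b)=-\log\mathrm{vol}(b)\in[0,\infty]$. For an embedding $\phi\in\binom{V_n}{V_N}$ and measurable $b\subseteq[0,1]^{V_n}$, the strict projection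 $b_{\downarrow\phi}\subseteq[0,1]^{V_N}$ is the set of those $c\in[0,1]^{V_N}$ for which the slice $\{\tilde c\in b:\tilde c_{\phi(i)}=c_i\ \forall i\in V_N\}$ has positive $|V_n\setminus\phi(V_N)|$-dimensional volume. A \emph{$[0,1]$-decoration property} of $\mathbf V$ is a sequence $\mathcal P=(\mathcal P_n)_{n\in\mathbb N}$ of measurable sets $\mathcal P_n\subseteq[0,1]^{V_n}$. It is \emph{hereditary} if for all $N\le n$, every $\phi\in\binom{V_n}{V_N}$ and every $c\in[0,1]^{V_n}$ such that $(c_{\phi(i)})_{i\in V_N}\notin\mathcal P_N$, we have $c\notin\mathcal P_n$. Its \emph{extremal entropy} is \[\mathrm{ex}(V_n,\mathcal P_n)=\inf\{\mathrm{Ent}(b): b\text{ a box in }[0,1]^{V_n},\ \mathrm{vol}(b\setminus\mathcal P_n)=0\}\in[0,\infty].\] \textbf{Statement.} Let $\mathbf V$ be a good ssee and let $\mathcal P$ be a hereditary $[0,1]$-decoration property of $\mathbf V$. Suppose that (a) the limit $\pi(\mathcal P):=\lim_{n\to\infty}\mathrm{ex}(V_n,\mathcal P_n)/|V_n|$ exists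 as a (finite) real number; (b) for every $\varepsilon>0$ there exist $\eta>0$ and positive integers $N\le n_0$ such that for every $n\ge n_0$ and every box $b$ in $[0,1]^{V_n}$: if $\mathbb E_\phi\,\mathrm{vol}(b_{\downarrow\phi}\setminus\mathcal P_N)<\eta$, where $\phi$ is uniformly random in $\binom{V_n}{V_N}$ (the expectation being read as $0$ if there are no embeddings), then $\mathrm{Ent}(b)>(\pi(\mathcal P)-\varepsilon)|V_n|$. Then \[\mathrm{vol}(\mathcal P_n)=e^{-(\pi(\mathcal P)+o(1))|V_n|}\qquad(n\to\infty),\] that is, there is a real sequence $(o_n)$ with $o_n\to0$ such that $\mathrm{vol}(\mathcal P_n)=e^{-(\pi(\mathcal P)+o_n)|V_n|}$ for all sufficiently large $n$. -/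

import Mathlib

open Filter Topology MeasureTheory

universe u

noncomputable section

/-- A set sequence equipped with embeddings (ssee): a sequence of finite sets `V n`, together with
a collection `emb N n` of injections `V N → V n`. Only the collections with `N ≤ n` are ever
used. -/
structure SSEE where
  /-- the sets of the sequence -/
  V : ℕ → Type u
  /-- each of them is finite -/
  fintypeV : ∀ n, Fintype (V n)
  /-- the embeddings of `V N` into `V n` -/
  emb : ∀ N n : ℕ, Finset (V N ↪ V n)

namespace SSEE

instance (S : SSEE.{u}) (n : ℕ) : Fintype (S.V n) := S.fintypeV n

/-- The number of `i`-intersecting embeddings of `(V N₁, V N₂)` into `V n`. A map on the disjoint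
union `V N₁ ⊔ V N₂` is written as the pair of its two restrictions. -/
def intersectingCount (S : SSEE.{u}) (i N₁ N₂ n : ℕ) : ℕ :=
  Set.ncard {p : (S.V N₁ ↪ S.V n) × (S.V N₂ ↪ S.V n) |
    p.1 ∈ S.emb N₁ n ∧ p.2 ∈ S.emb N₂ n ∧ (Set.range p.1 ∩ Set.range p.2).ncard = i}

/-- `I(N, n)`: the number of pairs of embeddings of `V N` into `V n` that share more than one and
fewer than `|V N|` elements. -/
def intersectingSum (S : SSEE.{u}) (N n : ℕ) : ℕ :=
  ∑ i ∈ Finset.Ioo 1 (Fintype.card (S.V N)), S.intersectingCount i N N n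

/-- Good ssee-s. -/
structure IsGood (S : SSEE.{u}) : Prop where
  card_tendsto : Tendsto (fun n => Fintype.card (S.V n)) atTop atTop
  many_embeddings : ∀ N, 1 < Fintype.card (S.V N) →
    Tendsto (fun n => ((S.emb N n).card : ℝ) / (Fintype.card (S.V n) : ℝ)) atTop atTop
  few_intersecting : ∀ N, 1 < Fintype.card (S.V N) →
    Tendsto (fun n => ((Fintype.card (S.V n) : ℝ) * (S.intersectingSum N n : ℝ)) /
      ((S.emb N n).card : ℝ) ^ 2) atTop (𝓝 0)

end SSEE

/-- `[0,1]`-decorations of `V`, i.e. points of the cube `[0,1]^V`. It carries the product of the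
Lebesgue measures of its factors. -/
abbrev Decoration (V : Type u) : Type u := V → unitInterval

/-- Boxes: products of measurable subsets of `[0,1]`. -/
def IsBox {V : Type u} (b : Set (Decoration V)) : Prop :=
  ∃ A : V → Set unitInterval, (∀ i, MeasurableSet (A i)) ∧ b = {c | ∀ i, c i ∈ A i}

/-- `Ent b = - log (vol b)`, which is `+∞` when `vol b = 0`. -/
def entropy {V : Type u} [Fintype V] (b : Set (Decoration V)) : EReal :=
  -ENNReal.log (volume b)

open Classical in
/-- The strict projection `b_{↓φ}`: the points `c` for which the slice
`{x ∈ b | x (φ i) = c i for all i}` has positive volume in the coordinates outside `φ(W)`. -/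
def projection {W V : Type u} [Fintype V] (φ : W ↪ V) (b : Set (Decoration V)) :
    Set (Decoration W) :=
  {c | 0 < volume ((fun (x : Decoration V) (j : {j : V // j ∉ Set.range φ}) => x j.1) ''
    {x | x ∈ b ∧ ∀ i, x (φ i) = c i})}

/-- The lift `b_{↑φ}`. -/
def lift {W V : Type u} (φ : W ↪ V) (b : Set (Decoration W)) : Set (Decoration V) :=
  {c | ∃ c' ∈ b, ∀ i, c' i = c (φ i)}

/-- The upper shadow of `b ⊆ [0,1]^{V N}` in `[0,1]^{V n}`. -/
def upperShadow (S : SSEE.{u}) {N : ℕ} (n : ℕ) (b : Set (Decoration (S.V N))) :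
    Set (Decoration (S.V n)) :=
  ⋃ φ ∈ S.emb N n, lift φ b

/-- A `[0,1]`-decoration property: a sequence of measurable sets `P n ⊆ [0,1]^{V n}`. -/
structure DecorationProperty (S : SSEE.{u}) where
  body : ∀ n, Set (Decoration (S.V n))
  measurableSet_body : ∀ n, MeasurableSet (body n)

/-- A property is hereditary if its complement is closed under taking upper shadows. -/
def DecorationProperty.IsHereditary {S : SSEE.{u}} (P : DecorationProperty S) : Prop :=
  ∀ N n : ℕ, N ≤ n → upperShadow S n (P.body N)ᶜ ⊆ (P.body n)ᶜ

/-- The extremal entropy `ex(V, Q)` of `Q ⊆ [0,1]^V`: the infimum of the entropies of the boxes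
that lie in `Q` up to a null set. -/
def extremalEntropy {V : Type u} [Fintype V] (Q : Set (Decoration V)) : EReal :=
  sInf {e | ∃ b : Set (Decoration V), IsBox b ∧ volume (b \ Q) = 0 ∧ e = entropy b}

/-- The expectation over a uniformly random embedding `φ` of `V N` into `V n` of
`vol (b_{↓φ} \ Q)`; it is `0` if there are no embeddings. -/
def expectedExcess (S : SSEE.{u}) (N n : ℕ) (b : Set (Decoration (S.V n)))
    (Q : Set (Decoration (S.V N))) : ℝ :=
  (∑ φ ∈ S.emb N n, (volume (projection φ b \ Q)).toReal) / ((S.emb N n).card : ℝ)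

end

/-!
A box contained in `P.body n` up to a null set and of almost minimal entropy has volume
`e^{-(π + o(1)) |V_n|}`, which is the lower bound.

For the upper bound, measure the uncertainty of a coordinate `i` of a random point of `P.body n`
conditioned on a set of coordinates by a bounded convex energy, a substitute for the conditional
entropy. Goodness of `S` provides a set `T` of coordinates, touched by few embeddings `φ` of `V_N`,
such that on average over `φ` the energy of the coordinates in the image of `φ` barely increases
when this image is added to the conditioning: choose `T` to maximize the total energy minus a cost.
Then a random set does not pay for its cost, and since few pairs of embeddings meet in more than one
point, the image of a typical embedding behaves like a random set.

In a slice of `P.body n` over `T`, consider the box of those coordinate values that remain likely.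
A pattern on `φ` that is forbidden by heredity although each of its values is likely forces a sharp
drop of a conditional density, which costs energy. So these boxes have small expected excess on
average, saturation bounds their volume, and Gibbs' inequality bounds the measure of a slice by
`e^{|V_n| h(τ)}` times the `(1 - τ)`-th power of the volume of its box, where `τ` is the threshold
for being likely and `h` is the binary entropy.
-/

section Slices

variable {V : Type*} [DecidableEq V] {X : V → Type*}

/-- The section of `P` over the coordinates of `z` in `S`. It is kept as a set of full families,
whose coordinates in `S` are irrelevant, so that sections are again subsets of the same product. -/
def slice (P : Set (∀ i, X i)) (S : Finset V) (z : ∀ i, X i) : Set (∀ i, X i) :=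
  {x | S.piecewise z x ∈ P}

theorem slice_empty (P : Set (∀ i, X i)) (z : ∀ i, X i) : slice P ∅ z = P := by
  simp [slice]

theorem slice_congr (P : Set (∀ i, X i)) {S : Finset V} {z z' : ∀ i, X i}
    (h : ∀ i ∈ S, z i = z' i) : slice P S z = slice P S z' := by
  ext x
  simp only [slice, Set.mem_ofPred_eq, S.piecewise_congr h fun _ _ => rfl]

theorem slice_slice (P : Set (∀ i, X i)) (S T : Finset V) (z x : ∀ i, X i) :
    slice (slice P S z) T x = slice P (S ∪ T) (S.piecewise z x) := by
  have hpw (y : ∀ i, X i) :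
      S.piecewise z (T.piecewise x y) = (S ∪ T).piecewise (S.piecewise z x) y := by
    funext i
    by_cases hS : i ∈ S <;> by_cases hT : i ∈ T <;> simp [hS, hT]
  ext y
  simp only [slice, Set.mem_ofPred_eq, hpw]

theorem disjoint_slice {P G : Set (∀ i, X i)} {S T : Finset V}
    (hG : DependsOn (· ∈ G) (T : Set V)) (hTS : Disjoint T S) (hGP : Disjoint G P)
    (z : ∀ i, X i) : Disjoint G (slice P S z) := by
  refine Set.disjoint_left.2 fun x hxG hxP => Set.disjoint_left.1 hGP ?_ hxP
  refine (hG fun i hi => ?_).mp hxG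
  exact (Finset.piecewise_eq_of_notMem _ _ _ (Finset.disjoint_left.1 hTS hi)).symm

variable [∀ i, MeasurableSpace (X i)]

theorem measurable_piecewise_prod (S : Finset V) :
    Measurable fun p : (∀ i, X i) × (∀ i, X i) => S.piecewise p.1 p.2 := by
  refine measurable_pi_lambda _ fun i => ?_
  by_cases hi : i ∈ S
  · simp only [S.piecewise_eq_of_mem _ _ hi]
    fun_prop
  · simp only [S.piecewise_eq_of_notMem _ _ hi]
    fun_prop

theorem measurable_piecewise_right (S : Finset V) (z : ∀ i, X i) :
    Measurable fun x : ∀ i, X i => S.piecewise z x :=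
  (measurable_piecewise_prod S).comp measurable_prodMk_left

theorem measurableSet_slice {P : Set (∀ i, X i)} (hP : MeasurableSet P) (S : Finset V)
    (z : ∀ i, X i) : MeasurableSet (slice P S z) :=
  measurable_piecewise_right S z hP

variable [Fintype V] (μ : ∀ i, Measure (X i)) [∀ i, IsProbabilityMeasure (μ i)]

theorem measurePreserving_piecewise (S : Finset V) :
    MeasurePreserving (fun p : (∀ i, X i) × (∀ i, X i) => S.piecewise p.1 p.2)
      ((Measure.pi μ).prod (Measure.pi μ)) (Measure.pi μ) := by
  refine ⟨measurable_piecewise_prod S, (Measure.pi_eq fun s hs => ?_).symm⟩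
  have hpre : (fun p : (∀ i, X i) × (∀ i, X i) => S.piecewise p.1 p.2) ⁻¹' Set.univ.pi s =
      Set.univ.pi (S.piecewise s fun _ => Set.univ) ×ˢ
        Set.univ.pi (S.piecewise (fun _ => Set.univ) s) := by
    ext p
    simp only [Set.mem_preimage, Set.mem_univ_pi, Set.mem_prod, ← forall_and]
    refine forall_congr' fun i => ?_
    by_cases hi : i ∈ S <;> simp [hi]
  rw [Measure.map_apply (measurable_piecewise_prod S) (.univ_pi hs), hpre, Measure.prod_prod,
    Measure.pi_pi, Measure.pi_pi, ← Finset.prod_mul_distrib]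
  refine Finset.prod_congr rfl fun i _ => ?_
  by_cases hi : i ∈ S <;> simp [hi]

variable {μ} {f : (∀ i, X i) → ℝ}

theorem integrable_comp_piecewise (hf : Integrable f (Measure.pi μ)) (S : Finset V) :
    Integrable (fun p : (∀ i, X i) × (∀ i, X i) => f (S.piecewise p.1 p.2))
      ((Measure.pi μ).prod (Measure.pi μ)) :=
  (measurePreserving_piecewise μ S).integrable_comp_of_integrable hf

theorem integrable_integral_piecewise (hf : Integrable f (Measure.pi μ)) (S : Finset V) :
    Integrable (fun z => ∫ x, f (S.piecewise z x) ∂Measure.pi μ) (Measure.pi μ) :=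
  (integrable_comp_piecewise hf S).integral_prod_left

theorem integral_integral_piecewise (hf : Integrable f (Measure.pi μ)) (S : Finset V) :
    ∫ z, ∫ x, f (S.piecewise z x) ∂Measure.pi μ ∂Measure.pi μ = ∫ x, f x ∂Measure.pi μ := by
  have hpw := measurePreserving_piecewise μ S
  rw [← integral_prod (fun p : (∀ i, X i) × (∀ i, X i) => f (S.piecewise p.1 p.2))
    (integrable_comp_piecewise hf S), ← integral_map hpw.aemeasurable (f := f), hpw.map_eq]
  rw [hpw.map_eq]
  exact hf.aestronglyMeasurable

end Slices

section MarginalDensity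

variable {V : Type*} [Fintype V] [DecidableEq V] {X : V → Type*} [∀ i, MeasurableSpace (X i)]

/-- The density of the coordinates in `S` of a `Measure.pi μ`-random point restricted to `P`, as a
function on the whole product. -/
noncomputable def marginalDensity (μ : ∀ i, Measure (X i)) (P : Set (∀ i, X i)) (S : Finset V)
    (z : ∀ i, X i) : ℝ :=
  (Measure.pi μ).real (slice P S z)

variable {μ : ∀ i, Measure (X i)} {P : Set (∀ i, X i)} {S T : Finset V} {x z z' : ∀ i, X i}

theorem marginalDensity_nonneg : 0 ≤ marginalDensity μ P S z :=
  measureReal_nonneg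

theorem marginalDensity_empty : marginalDensity μ P ∅ z = (Measure.pi μ).real P := by
  rw [marginalDensity, slice_empty]

theorem marginalDensity_congr (h : ∀ i ∈ S, z i = z' i) :
    marginalDensity μ P S z = marginalDensity μ P S z' := by
  rw [marginalDensity, slice_congr P h, marginalDensity]

theorem marginalDensity_slice :
    marginalDensity μ (slice P S z) T x = marginalDensity μ P (S ∪ T) (S.piecewise z x) := by
  rw [marginalDensity, slice_slice, marginalDensity]

variable [∀ i, IsProbabilityMeasure (μ i)]

theorem marginalDensity_le_one : marginalDensity μ P S z ≤ 1 :=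
  measureReal_le_one

theorem measurable_marginalDensity (hP : MeasurableSet P) (S : Finset V) :
    Measurable (marginalDensity μ P S) :=
  (measurable_measure_prodMk_left (measurable_piecewise_prod S hP)).ennreal_toReal

theorem integrable_marginalDensity (hP : MeasurableSet P) (S : Finset V) :
    Integrable (marginalDensity μ P S) (Measure.pi μ) :=
  .of_mem_Icc 0 1 (measurable_marginalDensity hP S).aemeasurable <|
    .of_forall fun _ => ⟨marginalDensity_nonneg, marginalDensity_le_one⟩

theorem integral_marginalDensity (hP : MeasurableSet P) (S : Finset V) :
    ∫ z, marginalDensity μ P S z ∂Measure.pi μ = (Measure.pi μ).real P := by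
  have hind : Integrable (P.indicator (1 : (∀ i, X i) → ℝ)) (Measure.pi μ) :=
    (integrable_const 1).indicator hP
  rw [← integral_indicator_one hP, ← integral_integral_piecewise hind S]
  refine integral_congr_ae (.of_forall fun z => ?_)
  rw [marginalDensity, ← integral_indicator_one (measurableSet_slice hP S z)]
  rfl

theorem integral_marginalDensity_union (hP : MeasurableSet P) (S T : Finset V) (z : ∀ i, X i) :
    ∫ x, marginalDensity μ P (S ∪ T) (S.piecewise z x) ∂Measure.pi μ = marginalDensity μ P S z := by
  simp only [← marginalDensity_slice]
  exact integral_marginalDensity (measurableSet_slice hP S z) T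

end MarginalDensity

section Energy

variable {τ : ℝ}

theorem sq_div_add_le_left {a b : ℝ} (ha : 0 ≤ a) (hb : 0 ≤ b) : a ^ 2 / (a + b) ≤ a := by
  rcases ha.eq_or_lt with rfl | ha'
  · simp
  · rw [div_le_iff₀ (by positivity)]
    nlinarith

/-- The left side is the tangent plane of the convex function `c ^ 2 / (c + d)` along the ray
`c / (c + d) = p`. -/
theorem tangent_le_sq_div_add {p c d : ℝ} (hc : 0 ≤ c) (hd : 0 ≤ d) :
    2 * p * c - p ^ 2 * (c + d) ≤ c ^ 2 / (c + d) := by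
  rcases (add_nonneg hc hd).eq_or_lt with h | h
  · have hc0 : c = 0 := by linarith
    rw [← h, hc0]
    simp
  · rw [le_div_iff₀ h]
    nlinarith [sq_nonneg (c - p * (c + d))]

theorem tangent_add_le_sq_div_add {p c d : ℝ} (hc : 0 ≤ c) (hd : 0 ≤ d) (hτ : 0 ≤ τ)
    (hτ1 : τ ≤ 1) (hp0 : 0 ≤ p) (hp : p * (1 + τ) ≤ 1) (hdc : d ≤ τ / 2 * c) :
    2 * p * c - p ^ 2 * (c + d) + τ ^ 2 / 24 * c ≤ c ^ 2 / (c + d) := by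
  rcases hc.eq_or_lt with rfl | hc'
  · simpa using tangent_le_sq_div_add (p := p) hc hd
  have hgap : c * (τ / 4) ≤ c - p * (c + d) := by
    have hpcd : p * (c + d) ≤ p * ((1 + τ / 2) * c) := by gcongr; linarith
    have hp' : p * (1 + τ / 2) ≤ 1 - τ / 4 := by nlinarith
    nlinarith [mul_le_mul_of_nonneg_right hp' hc]
  have hgap_sq : (c * (τ / 4)) ^ 2 ≤ (c - p * (c + d)) ^ 2 := by gcongr
  have hgain : τ ^ 2 / 24 * c * (c + d) ≤ (c * (τ / 4)) ^ 2 := by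
    have hcd : c + d ≤ 3 / 2 * c := by nlinarith
    calc τ ^ 2 / 24 * c * (c + d) ≤ τ ^ 2 / 24 * c * (3 / 2 * c) := by gcongr
      _ = (c * (τ / 4)) ^ 2 := by ring
  rw [le_div_iff₀ (by linarith)]
  nlinarith

/-- Jensen's inequality for the convex function `c ^ 2 / (c + d)`, with a gain on a set on which
`d / c` falls well below its mean value. -/
theorem sq_div_add_integral_add_le {Ω : Type*} [MeasurableSpace Ω] {ν : Measure Ω} {c d : Ω → ℝ}
    (hcint : Integrable c ν) (hdint : Integrable d ν) (hc : ∀ y, 0 ≤ c y) (hd : ∀ y, 0 ≤ d y)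
    (hτ : 0 ≤ τ) (hτ1 : τ ≤ 1) {D : Set Ω} (hD : MeasurableSet D)
    (hdrop : ∀ y ∈ D, τ * ∫ y, c y ∂ν < ∫ y, d y ∂ν ∧ d y ≤ τ / 2 * c y) :
    (∫ y, c y ∂ν) ^ 2 / (∫ y, c y ∂ν + ∫ y, d y ∂ν) + τ ^ 2 / 24 * ∫ y in D, c y ∂ν ≤
      ∫ y, c y ^ 2 / (c y + d y) ∂ν := by
  set a := ∫ y, c y ∂ν
  set b := ∫ y, d y ∂ν
  set p := a / (a + b)
  have ha : 0 ≤ a := integral_nonneg hc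
  have hb : 0 ≤ b := integral_nonneg hd
  have hcd : Integrable (fun y => c y + d y) ν := hcint.add hdint
  have htangent : ∫ y, 2 * p * c y - p ^ 2 * (c y + d y) ∂ν = a ^ 2 / (a + b) := by
    rw [integral_sub (hcint.const_mul _) (hcd.const_mul _), integral_const_mul,
      integral_const_mul, integral_add hcint hdint]
    change 2 * (a / (a + b)) * a - (a / (a + b)) ^ 2 * (a + b) = _
    rcases (add_nonneg ha hb).eq_or_lt with h | h
    · simp [← h]
    · field_simp
      ring
  have hint_tangent : Integrable (fun y => 2 * p * c y - p ^ 2 * (c y + d y)) ν :=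
    (hcint.const_mul _).sub (hcd.const_mul _)
  have hint_drop := (hcint.indicator hD).const_mul (τ ^ 2 / 24)
  have hint : Integrable (fun y => c y ^ 2 / (c y + d y)) ν := by
    refine hcint.mono (((hcint.aemeasurable.pow_const 2).div
      hcd.aemeasurable).aestronglyMeasurable) (.of_forall fun y => ?_)
    rw [Real.norm_of_nonneg (hc y),
      Real.norm_of_nonneg (div_nonneg (sq_nonneg _) (add_nonneg (hc y) (hd y)))]
    exact sq_div_add_le_left (hc y) (hd y)
  rw [← htangent, ← integral_indicator hD, ← integral_const_mul,
    ← integral_add hint_tangent hint_drop]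
  refine integral_mono (hint_tangent.add hint_drop) hint fun y => ?_
  by_cases hy : y ∈ D
  · obtain ⟨hab, hdc⟩ := hdrop y hy
    have hp : p * (1 + τ) ≤ 1 := by
      rw [div_mul_eq_mul_div, div_le_one (by nlinarith)]
      nlinarith
    simpa only [Set.indicator_of_mem hy] using tangent_add_le_sq_div_add (hc y) (hd y) hτ hτ1
      (div_nonneg ha (add_nonneg ha hb)) hp hdc
  · simpa only [Set.indicator_of_notMem hy, mul_zero, add_zero] using
      tangent_le_sq_div_add (hc y) (hd y)

variable {V : Type*} [Fintype V] [DecidableEq V] {X : V → Type*} [∀ i, MeasurableSpace (X i)]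

/-- The integrand of `energy`. Writing `t` for the density of the coordinate `i` conditional on
the coordinates in `S`, it is the density of the latter times the convex function
`1 / (1 + t)`. -/
noncomputable def energyDensity (μ : ∀ i, Measure (X i)) (P : Set (∀ i, X i)) (i : V)
    (S : Finset V) (x : ∀ i, X i) : ℝ :=
  marginalDensity μ P (S.erase i) x ^ 2 /
    (marginalDensity μ P (S.erase i) x + marginalDensity μ P (insert i S) x)

/-- A bounded quantity measuring how much the conditional law of the coordinate `i` of a random
point of `P` varies with the coordinates in `S`; it plays the part of the conditional entropy of
the coordinate `i`. The coordinate `i` is never conditioned on, whether or not it is in `S`. -/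
noncomputable def energy (μ : ∀ i, Measure (X i)) (P : Set (∀ i, X i)) (i : V)
    (S : Finset V) : ℝ :=
  ∫ x, energyDensity μ P i S x ∂Measure.pi μ

variable {μ : ∀ i, Measure (X i)} {P Q : Set (∀ i, X i)} {i : V} {S T : Finset V}
  {x z : ∀ i, X i}

theorem energyDensity_nonneg : 0 ≤ energyDensity μ P i S x :=
  div_nonneg (sq_nonneg _) (add_nonneg marginalDensity_nonneg marginalDensity_nonneg)

theorem energyDensity_le : energyDensity μ P i S x ≤ marginalDensity μ P (S.erase i) x :=
  sq_div_add_le_left marginalDensity_nonneg marginalDensity_nonneg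

theorem energy_nonneg : 0 ≤ energy μ P i S :=
  integral_nonneg fun _ => energyDensity_nonneg

theorem energy_erase : energy μ P i (S.erase i) = energy μ P i S := by
  have hinsert : insert i (S.erase i) = insert i S := by ext j; by_cases hj : j = i <;> simp [hj]
  simp only [energy, energyDensity, Finset.erase_idem, hinsert]

theorem energy_union_erase : energy μ P i (S ∪ T.erase i) = energy μ P i (S ∪ T) := by
  rw [← energy_erase, ← energy_erase (S := S ∪ T), Finset.erase_union_distrib,
    Finset.erase_idem, Finset.erase_union_distrib]

theorem energyDensity_slice (hi : i ∉ S) :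
    energyDensity μ (slice P S z) i T x = energyDensity μ P i (S ∪ T) (S.piecewise z x) := by
  simp only [energyDensity, marginalDensity_slice, Finset.erase_union_distrib,
    Finset.erase_eq_of_notMem hi, Finset.union_insert]

variable [∀ i, IsProbabilityMeasure (μ i)]

theorem measurable_energyDensity (hP : MeasurableSet P) (i : V) (S : Finset V) :
    Measurable (energyDensity μ P i S) :=
  ((measurable_marginalDensity hP _).pow_const 2).div
    ((measurable_marginalDensity hP _).add (measurable_marginalDensity hP _))

theorem integrable_energyDensity (hP : MeasurableSet P) (i : V) (S : Finset V) :
    Integrable (energyDensity μ P i S) (Measure.pi μ) :=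
  .of_mem_Icc 0 1 (measurable_energyDensity hP i S).aemeasurable <|
    .of_forall fun _ => ⟨energyDensity_nonneg, energyDensity_le.trans marginalDensity_le_one⟩

theorem energy_le_measureReal (hP : MeasurableSet P) : energy μ P i S ≤ (Measure.pi μ).real P := by
  rw [← integral_marginalDensity hP (S.erase i)]
  exact integral_mono (integrable_energyDensity hP i S) (integrable_marginalDensity hP _)
    fun _ => energyDensity_le

theorem integrable_energy_slice (hP : MeasurableSet P) (hi : i ∉ S) (T : Finset V) :
    Integrable (fun z => energy μ (slice P S z) i T) (Measure.pi μ) := by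
  simpa only [energy, energyDensity_slice hi] using
    integrable_integral_piecewise (integrable_energyDensity hP i (S ∪ T)) S

theorem integral_energy_slice (hP : MeasurableSet P) (hi : i ∉ S) (T : Finset V) :
    ∫ z, energy μ (slice P S z) i T ∂Measure.pi μ = energy μ P i (S ∪ T) := by
  simpa only [energy, energyDensity_slice hi] using
    integral_integral_piecewise (integrable_energyDensity hP i (S ∪ T)) S

/-- The points whose coordinate `i` has density more than `τ` given `Q`, but at most `τ / 2` once
the coordinates in `T` are known as well. -/
def dropSet (μ : ∀ i, Measure (X i)) (Q : Set (∀ i, X i)) (τ : ℝ) (i : V) (T : Finset V) :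
    Set (∀ i, X i) :=
  {x | τ * (Measure.pi μ).real Q < marginalDensity μ Q {i} x ∧
    marginalDensity μ Q (insert i T) x ≤ τ / 2 * marginalDensity μ Q T x}

theorem measurableSet_dropSet (hQ : MeasurableSet Q) (τ : ℝ) (i : V) (T : Finset V) :
    MeasurableSet (dropSet μ Q τ i T) :=
  (measurableSet_lt measurable_const (measurable_marginalDensity hQ _)).inter
    (measurableSet_le (measurable_marginalDensity hQ _)
      ((measurable_marginalDensity hQ _).const_mul _))

theorem energyDensity_empty_add_le_integral (hQ : MeasurableSet Q) (hi : i ∉ T) (hτ : 0 ≤ τ)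
    (hτ1 : τ ≤ 1) (x : ∀ i, X i) :
    energyDensity μ Q i ∅ x + τ ^ 2 / 24 *
        ∫ y, (dropSet μ Q τ i T).indicator (marginalDensity μ Q T)
          (Finset.piecewise {i} x y) ∂Measure.pi μ ≤
      ∫ y, energyDensity μ Q i T (Finset.piecewise {i} x y) ∂Measure.pi μ := by
  have hpw := measurable_piecewise_right {i} x
  let D := {y | Finset.piecewise {i} x y ∈ dropSet μ Q τ i T}
  let d := fun y => marginalDensity μ Q (insert i T) (Finset.piecewise {i} x y)
  have hc (y) : marginalDensity μ Q T (Finset.piecewise {i} x y) = marginalDensity μ Q T y :=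
    marginalDensity_congr fun j hj =>
      Finset.piecewise_eq_of_notMem _ _ _ (by simpa using ne_of_mem_of_not_mem hj hi)
  have hD : MeasurableSet D := hpw (measurableSet_dropSet hQ τ i T)
  have hint_d : Integrable d (Measure.pi μ) :=
    .of_mem_Icc 0 1 ((measurable_marginalDensity hQ _).comp hpw).aemeasurable <|
      .of_forall fun _ => ⟨marginalDensity_nonneg, marginalDensity_le_one⟩
  have hmean_c : ∫ y, marginalDensity μ Q T y ∂Measure.pi μ = (Measure.pi μ).real Q :=
    integral_marginalDensity hQ T
  have hmean_d : ∫ y, d y ∂Measure.pi μ = marginalDensity μ Q {i} x :=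
    integral_marginalDensity_union hQ {i} T x
  have hdrop : ∀ y ∈ D, τ * ∫ y, marginalDensity μ Q T y ∂Measure.pi μ < ∫ y, d y ∂Measure.pi μ ∧
      d y ≤ τ / 2 * marginalDensity μ Q T y := by
    intro y hy
    have hx : marginalDensity μ Q {i} (Finset.piecewise {i} x y) = marginalDensity μ Q {i} x :=
      marginalDensity_congr fun j hj => Finset.piecewise_eq_of_mem _ _ _ hj
    simpa only [D, dropSet, Set.mem_ofPred_eq, hx, hc, hmean_c, hmean_d] using hy
  have hind (y) : (dropSet μ Q τ i T).indicator (marginalDensity μ Q T)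
      (Finset.piecewise {i} x y) = D.indicator (marginalDensity μ Q T) y := by
    simp only [Set.indicator, D, Set.mem_ofPred_eq, hc]
  have hgain := sq_div_add_integral_add_le (integrable_marginalDensity hQ T) hint_d
    (fun _ => marginalDensity_nonneg) (fun _ => marginalDensity_nonneg) hτ hτ1 hD hdrop
  simpa only [hind, integral_indicator hD, energyDensity, hc, Finset.erase_eq_of_notMem hi,
    Finset.erase_empty, marginalDensity_empty, insert_empty_eq, hmean_c, hmean_d] using hgain

theorem energy_empty_add_setIntegral_dropSet_le (hQ : MeasurableSet Q) (hi : i ∉ T) (hτ : 0 ≤ τ)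
    (hτ1 : τ ≤ 1) :
    energy μ Q i ∅ + τ ^ 2 / 24 * ∫ x in dropSet μ Q τ i T, marginalDensity μ Q T x ∂Measure.pi μ ≤
      energy μ Q i T := by
  have hdrop : Integrable ((dropSet μ Q τ i T).indicator (marginalDensity μ Q T))
      (Measure.pi μ) :=
    (integrable_marginalDensity hQ T).indicator (measurableSet_dropSet hQ τ i T)
  have hdrop' := (integrable_integral_piecewise hdrop {i}).const_mul (τ ^ 2 / 24)
  rw [← integral_indicator (measurableSet_dropSet hQ τ i T), energy, energy,
    ← integral_integral_piecewise (integrable_energyDensity hQ i T) {i},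
    ← integral_integral_piecewise hdrop {i}, ← integral_const_mul,
    ← integral_add (integrable_energyDensity hQ i ∅) hdrop']
  exact integral_mono ((integrable_energyDensity hQ i ∅).add hdrop')
    (integrable_integral_piecewise (integrable_energyDensity hQ i T) {i})
    (energyDensity_empty_add_le_integral hQ hi hτ hτ1)

theorem energy_empty_le (hQ : MeasurableSet Q) : energy μ Q i ∅ ≤ energy μ Q i T := by
  rw [← energy_erase (S := T)]
  simpa using energy_empty_add_setIntegral_dropSet_le hQ (T.notMem_erase i) le_rfl zero_le_one

theorem energy_mono (hP : MeasurableSet P) (hST : S ⊆ T) : energy μ P i S ≤ energy μ P i T := by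
  have hi := S.notMem_erase i
  have hunion : S.erase i ∪ T = T := Finset.union_eq_right.2 ((S.erase_subset i).trans hST)
  calc energy μ P i S = ∫ z, energy μ (slice P (S.erase i) z) i ∅ ∂Measure.pi μ := by
        rw [integral_energy_slice hP hi, Finset.union_empty, energy_erase]
    _ ≤ ∫ z, energy μ (slice P (S.erase i) z) i T ∂Measure.pi μ :=
        integral_mono (integrable_energy_slice hP hi _) (integrable_energy_slice hP hi _) fun z =>
          energy_empty_le (measurableSet_slice hP _ z)
    _ = energy μ P i T := by rw [integral_energy_slice hP hi, hunion]

end Energy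

theorem exists_drop_or_pow_card_mul_le {V : Type*} [DecidableEq V] (g : Finset V → ℝ) {t : ℝ}
    (ht : 0 ≤ t) (R : Finset V) :
    (∃ i ∈ R, ∃ T ⊆ R.erase i, g (insert i T) ≤ t * g T ∧ t ^ T.card * g ∅ ≤ g T) ∨
      t ^ R.card * g ∅ ≤ g R := by
  induction R using Finset.induction_on with
  | empty => simp
  | insert a S ha ih =>
    rcases ih with ⟨i, hi, T, hT, hdrop⟩ | hS
    · exact .inl ⟨i, Finset.mem_insert_of_mem hi, T,
        hT.trans (Finset.erase_subset_erase i (S.subset_insert a)), hdrop⟩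
    · rcases le_or_gt (g (insert a S)) (t * g S) with hdrop | hkeep
      · exact .inl ⟨a, S.mem_insert_self a, S, by rw [Finset.erase_insert ha], hdrop, hS⟩
      · refine .inr ?_
        rw [Finset.card_insert_of_notMem ha, pow_succ', mul_assoc]
        exact (mul_le_mul_of_nonneg_left hS ht).trans hkeep.le

section LikelyValues

variable {V : Type*} [Fintype V] [DecidableEq V] {X : V → Type*} [∀ i, MeasurableSpace (X i)]

/-- The values of the coordinate `i` whose density, for a `Measure.pi μ`-random point conditioned
to lie in `Q`, exceeds `τ`. -/
def likelyValues (μ : ∀ i, Measure (X i)) (Q : Set (∀ i, X i)) (τ : ℝ) (i : V) : Set (X i) :=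
  {y | τ * (Measure.pi μ).real Q < (Measure.pi μ).real {x | Function.update x i y ∈ Q}}

variable {μ : ∀ i, Measure (X i)} {Q F : Set (∀ i, X i)} {τ : ℝ} {i : V} {R T : Finset V}

theorem mem_likelyValues_iff {x : ∀ i, X i} :
    x i ∈ likelyValues μ Q τ i ↔ τ * (Measure.pi μ).real Q < marginalDensity μ Q {i} x := by
  simp only [likelyValues, marginalDensity, slice, Finset.piecewise_singleton, Set.mem_ofPred_eq]

theorem marginalDensity_eq_zero_of_disjoint (hdep : DependsOn (· ∈ F) (R : Set V))
    (hFQ : Disjoint F Q) {x : ∀ i, X i} (hx : x ∈ F) : marginalDensity μ Q R x = 0 := by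
  have hempty : slice Q R x = ∅ := by
    refine Set.eq_empty_of_forall_notMem fun y hy => Set.disjoint_left.1 hFQ ?_ hy
    exact (hdep fun i hi => R.piecewise_eq_of_mem x y hi).mpr hx
  rw [marginalDensity, hempty, measureReal_empty]

/-- A point of `F` whose coordinates in `R` are all likely has density zero at `R`, so revealing
its coordinates one at a time must make the density drop at some point. -/
theorem inter_pi_likelyValues_subset (hdep : DependsOn (· ∈ F) (R : Set V))
    (hFQ : Disjoint F Q) (hQ : 0 < (Measure.pi μ).real Q) (hτ : 0 < τ) (hτ2 : τ ≤ 2) :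
    F ∩ (R : Set V).pi (likelyValues μ Q τ) ⊆
      ⋃ i ∈ R, ⋃ T ∈ (R.erase i).powerset, dropSet μ Q τ i T ∩
        {x | (τ / 2) ^ R.card * (Measure.pi μ).real Q ≤ marginalDensity μ Q T x} := by
  rintro x ⟨hxF, hxA⟩
  have hpow {k : ℕ} (hk : k ≤ R.card) : (τ / 2) ^ R.card * (Measure.pi μ).real Q ≤
      (τ / 2) ^ k * (Measure.pi μ).real Q :=
    mul_le_mul_of_nonneg_right (pow_le_pow_of_le_one (by positivity) (by linarith) hk) hQ.le
  rcases exists_drop_or_pow_card_mul_le (fun T => marginalDensity μ Q T x) (half_pos hτ).le R with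
    ⟨i, hi, T, hT, hdrop, hlarge⟩ | hzero
  · simp only [Set.mem_iUnion, Finset.mem_powerset]
    rw [marginalDensity_empty] at hlarge
    exact ⟨i, hi, T, hT, ⟨mem_likelyValues_iff.1 (hxA i hi), hdrop⟩,
      (hpow (Finset.card_le_card (hT.trans (R.erase_subset i)))).trans hlarge⟩
  · rw [marginalDensity_empty, marginalDensity_eq_zero_of_disjoint hdep hFQ hxF] at hzero
    exact absurd hzero (not_le.2 (by positivity))

variable [∀ i, IsProbabilityMeasure (μ i)]

theorem measurableSet_likelyValues (hQ : MeasurableSet Q) (τ : ℝ) (i : V) :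
    MeasurableSet (likelyValues μ Q τ i) :=
  measurableSet_lt measurable_const
    (measurable_measure_prodMk_right (measurable_update' hQ)).ennreal_toReal

theorem measureReal_inter_unlikely_le (hQ : MeasurableSet Q) (hτ : 0 ≤ τ) (i : V) :
    (Measure.pi μ).real (Q ∩ {x | x i ∉ likelyValues μ Q τ i}) ≤ τ * (Measure.pi μ).real Q := by
  set U := {x : ∀ i, X i | x i ∉ likelyValues μ Q τ i}
  have hU : MeasurableSet U := (measurable_pi_apply i) (measurableSet_likelyValues hQ τ i).compl
  have hslice (z) : marginalDensity μ (Q ∩ U) {i} z ≤ τ * (Measure.pi μ).real Q := by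
    by_cases hz : z ∈ U
    · calc marginalDensity μ (Q ∩ U) {i} z ≤ marginalDensity μ Q {i} z :=
            measureReal_mono fun x hx => hx.1
        _ ≤ τ * (Measure.pi μ).real Q := not_lt.1 (mt mem_likelyValues_iff.2 hz)
    · have hempty : slice (Q ∩ U) {i} z = ∅ :=
        Set.eq_empty_of_forall_notMem fun x hx => hz (by simpa [U] using hx.2)
      rw [marginalDensity, hempty, measureReal_empty]
      positivity
  calc (Measure.pi μ).real (Q ∩ U) = ∫ z, marginalDensity μ (Q ∩ U) {i} z ∂Measure.pi μ :=
        (integral_marginalDensity (hQ.inter hU) {i}).symm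
    _ ≤ ∫ _, τ * (Measure.pi μ).real Q ∂Measure.pi μ :=
        integral_mono (integrable_marginalDensity (hQ.inter hU) {i}) (integrable_const _) hslice
    _ = τ * (Measure.pi μ).real Q := by simp

theorem measureReal_dropSet_inter_mul_le (hQ : MeasurableSet Q) (hτ : 0 < τ) (hτ1 : τ ≤ 1)
    (hiT : i ∉ T) (hTR : T ⊆ R) (θ : ℝ) :
    (Measure.pi μ).real (dropSet μ Q τ i T ∩ {x | θ ≤ marginalDensity μ Q T x}) * θ ≤
      24 / τ ^ 2 * (energy μ Q i R - energy μ Q i ∅) := by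
  set D := dropSet μ Q τ i T
  have hD : MeasurableSet D := measurableSet_dropSet hQ τ i T
  have hint := integrable_marginalDensity (μ := μ) hQ T
  have hmarkov : (Measure.pi μ).real (D ∩ {x | θ ≤ marginalDensity μ Q T x}) * θ ≤
      ∫ x in D, marginalDensity μ Q T x ∂Measure.pi μ := by
    have h := mul_meas_ge_le_integral_of_nonneg (μ := (Measure.pi μ).restrict D)
      (.of_forall fun _ => marginalDensity_nonneg) hint.integrableOn θ
    rwa [measureReal_restrict_apply' hD, Set.inter_comm, mul_comm] at h
  have hincrement := energy_empty_add_setIntegral_dropSet_le (μ := μ) hQ hiT hτ.le hτ1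
  have hmono := energy_mono (μ := μ) (i := i) hQ hTR
  refine hmarkov.trans ?_
  rw [div_mul_eq_mul_div, le_div_iff₀ (by positivity)]
  linarith

theorem sum_measureReal_dropSet_inter_mul_le (hQ : MeasurableSet Q) (hτ : 0 < τ) (hτ1 : τ ≤ 1)
    (i : V) (R : Finset V) (θ : ℝ) :
    (∑ T ∈ (R.erase i).powerset,
        (Measure.pi μ).real (dropSet μ Q τ i T ∩ {x | θ ≤ marginalDensity μ Q T x})) * θ ≤
      2 ^ R.card * (24 / τ ^ 2 * (energy μ Q i R - energy μ Q i ∅)) := by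
  have hgain : 0 ≤ energy μ Q i R - energy μ Q i ∅ := sub_nonneg.2 (energy_empty_le hQ)
  calc _ ≤ ∑ T ∈ (R.erase i).powerset, 24 / τ ^ 2 * (energy μ Q i R - energy μ Q i ∅) := by
        rw [Finset.sum_mul]
        refine Finset.sum_le_sum fun T hT => ?_
        rw [Finset.mem_powerset, Finset.subset_erase] at hT
        exact measureReal_dropSet_inter_mul_le hQ hτ hτ1 hT.2 hT.1 θ
    _ = 2 ^ (R.erase i).card * (24 / τ ^ 2 * (energy μ Q i R - energy μ Q i ∅)) := by simp
    _ ≤ 2 ^ R.card * (24 / τ ^ 2 * (energy μ Q i R - energy μ Q i ∅)) := by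
        gcongr
        · exact one_le_two
        · exact R.erase_subset i

theorem measureReal_inter_pi_likelyValues_mul_le (hQ : MeasurableSet Q)
    (hdep : DependsOn (· ∈ F) (R : Set V)) (hFQ : Disjoint F Q) (hτ : 0 < τ) (hτ1 : τ ≤ 1) :
    (Measure.pi μ).real (F ∩ (R : Set V).pi (likelyValues μ Q τ)) * (Measure.pi μ).real Q ≤
      (4 / τ) ^ R.card * (24 / τ ^ 2) * ∑ i ∈ R, (energy μ Q i R - energy μ Q i ∅) := by
  set m := (Measure.pi μ).real Q with hmdef
  set G := F ∩ (R : Set V).pi (likelyValues μ Q τ)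
  rcases (measureReal_nonneg : 0 ≤ m).eq_or_lt with hm | hm
  · rw [hmdef, ← hm, mul_zero]
    exact mul_nonneg (by positivity)
      (Finset.sum_nonneg fun i _ => sub_nonneg.2 (energy_empty_le hQ))
  set θ := (τ / 2) ^ R.card * m
  set B := fun i T => dropSet μ Q τ i T ∩ {x | θ ≤ marginalDensity μ Q T x}
  have hunion : (Measure.pi μ).real G ≤
      ∑ i ∈ R, ∑ T ∈ (R.erase i).powerset, (Measure.pi μ).real (B i T) :=
    calc _ ≤ (Measure.pi μ).real (⋃ i ∈ R, ⋃ T ∈ (R.erase i).powerset, B i T) :=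
          measureReal_mono (inter_pi_likelyValues_subset hdep hFQ hm hτ (by linarith))
            (measure_ne_top _ _)
      _ ≤ ∑ i ∈ R, (Measure.pi μ).real (⋃ T ∈ (R.erase i).powerset, B i T) :=
          measureReal_biUnion_finset_le _ _
      _ ≤ _ := Finset.sum_le_sum fun i _ => measureReal_biUnion_finset_le _ _
  calc (Measure.pi μ).real G * m = (2 / τ) ^ R.card * ((Measure.pi μ).real G * θ) := by
        simp only [θ, div_pow]
        field_simp
    _ ≤ (2 / τ) ^ R.card *
          ∑ i ∈ R, 2 ^ R.card * (24 / τ ^ 2 * (energy μ Q i R - energy μ Q i ∅)) := by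
        refine mul_le_mul_of_nonneg_left ?_ (by positivity)
        refine (mul_le_mul_of_nonneg_right hunion (by positivity)).trans ?_
        rw [Finset.sum_mul]
        exact Finset.sum_le_sum fun i _ => sum_measureReal_dropSet_inter_mul_le hQ hτ hτ1 i R θ
    _ = (4 / τ) ^ R.card * (24 / τ ^ 2) * ∑ i ∈ R, (energy μ Q i R - energy μ Q i ∅) := by
        rw [← Finset.mul_sum, ← Finset.mul_sum, ← mul_assoc, ← mul_pow, ← mul_assoc]
        ring_nf

end LikelyValues

section EntropyBound

/-- Gibbs' inequality: a subprobability density `q` is, on average over `Q`, no larger than the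
uniform density on `Q`. -/
theorem setIntegral_log_le_negMulLog {Ω : Type*} [MeasurableSpace Ω] {ν : Measure Ω}
    [IsFiniteMeasure ν] {q : Ω → ℝ} (hpos : ∀ x, 0 < q x) (hq : Integrable q ν)
    (hq1 : ∫ x, q x ∂ν ≤ 1) {Q : Set Ω} (hlog : IntegrableOn (fun x => Real.log (q x)) Q ν) :
    ∫ x in Q, Real.log (q x) ∂ν ≤ (ν.real Q).negMulLog := by
  set m := ν.real Q with hmdef
  rcases (measureReal_nonneg : 0 ≤ m).eq_or_lt with hm | hm
  · have hnull : ν Q = 0 := (measureReal_eq_zero_iff).1 hm.symm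
    rw [setIntegral_measure_zero _ hnull, hmdef, ← hm, Real.negMulLog_zero]
  have hpoint (x) : Real.log (q x) ≤ q x * m - (1 + Real.log m) := by
    have h := Real.log_le_sub_one_of_pos (mul_pos (hpos x) hm)
    rw [Real.log_mul (hpos x).ne' hm.ne'] at h
    linarith
  calc ∫ x in Q, Real.log (q x) ∂ν
      ≤ ∫ x in Q, (q x * m - (1 + Real.log m)) ∂ν :=
        integral_mono hlog ((hq.mul_const m).integrableOn.sub (integrable_const _)) hpoint
    _ = (∫ x in Q, q x ∂ν) * m - m * (1 + Real.log m) := by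
        rw [integral_sub (hq.mul_const m).integrableOn (integrable_const _), integral_mul_const,
          setIntegral_const, smul_eq_mul]
    _ ≤ 1 * m - m * (1 + Real.log m) := by
        gcongr
        exact (setIntegral_le_integral hq (.of_forall fun x => (hpos x).le)).trans hq1
    _ = m.negMulLog := by rw [Real.negMulLog]; ring

section TwoLevelDensity

variable {Y : Type*} [MeasurableSpace Y]

open Classical in
/-- A density of mass at most one that assumes the value `τ` off `A` and gives mass `1 - τ` to `A`;
it is compared with the law of a coordinate that is in `A` with probability at least `1 - τ`. -/
noncomputable def twoLevelDensity (ν : Measure Y) (A : Set Y) (τ : ℝ) : Y → ℝ :=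
  A.piecewise (fun _ => (1 - τ) / ν.real A) fun _ => τ

variable {ν : Measure Y} {A : Set Y} {τ : ℝ}

theorem twoLevelDensity_pos (hτ : 0 < τ) (hτ1 : τ < 1) (hA : 0 < ν.real A) (y : Y) :
    0 < twoLevelDensity ν A τ y := by
  have : 0 < 1 - τ := sub_pos.2 hτ1
  by_cases hy : y ∈ A <;> simp only [twoLevelDensity, Set.piecewise, hy, if_true, if_false] <;>
    positivity

theorem log_twoLevelDensity (hτ1 : τ < 1) (hA : 0 < ν.real A) (y : Y) :
    Real.log (twoLevelDensity ν A τ y) = Real.log (1 - τ) - Real.log (ν.real A) -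
      Aᶜ.indicator (fun _ => Real.log (1 - τ) - Real.log (ν.real A) - Real.log τ) y := by
  by_cases hy : y ∈ A
  · simp [twoLevelDensity, hy, Real.log_div (sub_pos.2 hτ1).ne' hA.ne']
  · simp [twoLevelDensity, hy]

variable [IsProbabilityMeasure ν]

theorem integrable_twoLevelDensity (hA : MeasurableSet A) (τ : ℝ) :
    Integrable (twoLevelDensity ν A τ) ν :=
  by classical exact .piecewise hA integrableOn_const integrableOn_const

theorem integral_twoLevelDensity_le_one (hτ : 0 ≤ τ) (hτ1 : τ ≤ 1) (hA : MeasurableSet A) :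
    ∫ y, twoLevelDensity ν A τ y ∂ν ≤ 1 := by
  classical
  rw [twoLevelDensity, integral_piecewise hA integrableOn_const integrableOn_const,
    setIntegral_const, setIntegral_const, smul_eq_mul, smul_eq_mul, probReal_compl_eq_one_sub hA]
  have hA0 : 0 ≤ ν.real A := measureReal_nonneg
  have hdiv : ν.real A * ((1 - τ) / ν.real A) ≤ 1 - τ := by
    rw [mul_div_left_comm]
    exact mul_le_of_le_one_right (sub_nonneg.2 hτ1) (div_self_le_one _)
  nlinarith

end TwoLevelDensity

variable {V : Type*} [Fintype V] {X : V → Type*} [∀ i, MeasurableSpace (X i)]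
  {μ : ∀ i, Measure (X i)} [∀ i, IsProbabilityMeasure (μ i)] {Q : Set (∀ i, X i)}
  {A : ∀ i, Set (X i)} {τ : ℝ}

theorem one_sub_mul_le_measureReal {i : V} (hA : MeasurableSet (A i))
    (hexc : (Measure.pi μ).real (Q ∩ {x | x i ∉ A i}) ≤ τ * (Measure.pi μ).real Q) :
    (1 - τ) * (Measure.pi μ).real Q ≤ (μ i).real (A i) := by
  have heval : (Measure.pi μ).real {x | x i ∈ A i} = (μ i).real (A i) :=
    (measurePreserving_eval μ i).measureReal_preimage hA.nullMeasurableSet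
  have hcover : (Measure.pi μ).real Q ≤ (Measure.pi μ).real {x | x i ∈ A i} +
      (Measure.pi μ).real (Q ∩ {x | x i ∉ A i}) :=
    (measureReal_mono fun x hx => (em (x i ∈ A i)).imp id fun h => ⟨hx, h⟩).trans
      (measureReal_union_le _ _)
  linarith

theorem integrable_log_twoLevelDensity {i : V} (hA : MeasurableSet (A i)) (hτ1 : τ < 1)
    (hA0 : 0 < (μ i).real (A i)) :
    Integrable (fun x => Real.log (twoLevelDensity (μ i) (A i) τ (x i))) (Measure.pi μ) := by
  simp only [log_twoLevelDensity hτ1 hA0]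
  exact (integrable_const _).sub ((integrable_const _).indicator (measurable_pi_apply i hA.compl))

/-- The integral is minus the measure of `Q` times the cross entropy, with `twoLevelDensity`, of the
coordinate `i` of a random point of `Q`. -/
theorem le_setIntegral_log_twoLevelDensity {i : V} (hA : MeasurableSet (A i)) (hτ : 0 < τ)
    (hτ2 : τ ≤ 1 / 2) (hA0 : 0 < (μ i).real (A i))
    (hexc : (Measure.pi μ).real (Q ∩ {x | x i ∉ A i}) ≤ τ * (Measure.pi μ).real Q) :
    -((1 - τ) * Real.log ((μ i).real (A i)) + Real.binEntropy τ) * (Measure.pi μ).real Q ≤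
      ∫ x in Q, Real.log (twoLevelDensity (μ i) (A i) τ (x i)) ∂Measure.pi μ := by
  set u := Real.log (1 - τ) - Real.log ((μ i).real (A i))
  set E := {x : ∀ i, X i | x i ∉ A i}
  have hE : MeasurableSet E := measurable_pi_apply i hA.compl
  have hu : Real.log τ ≤ u := by
    have hlogτ : Real.log τ ≤ Real.log (1 - τ) := Real.log_le_log hτ (by linarith)
    have hlogA : Real.log ((μ i).real (A i)) ≤ 0 :=
      Real.log_nonpos measureReal_nonneg measureReal_le_one
    linarith
  calc -((1 - τ) * Real.log ((μ i).real (A i)) + Real.binEntropy τ) * (Measure.pi μ).real Q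
      = (Measure.pi μ).real Q * u - τ * (Measure.pi μ).real Q * (u - Real.log τ) := by
        simp only [u, Real.binEntropy_eq_negMulLog_add_negMulLog_one_sub, Real.negMulLog]
        ring
    _ ≤ (Measure.pi μ).real Q * u - (Measure.pi μ).real (Q ∩ E) * (u - Real.log τ) := by
        gcongr
    _ = ∫ x in Q, (u - E.indicator (fun _ => u - Real.log τ) x) ∂Measure.pi μ := by
        rw [integral_sub (integrable_const _) ((integrable_const _).indicator hE),
          setIntegral_const, integral_indicator_const _ hE, measureReal_restrict_apply hE,
          Set.inter_comm, smul_eq_mul, smul_eq_mul]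
    _ = ∫ x in Q, Real.log (twoLevelDensity (μ i) (A i) τ (x i)) ∂Measure.pi μ := by
        simp only [log_twoLevelDensity (by linarith : τ < 1) hA0]
        rfl

/-- The entropy of a random point of `Q` is at most its cross entropy with the product of the
densities `twoLevelDensity (μ i) (A i) τ`. -/
theorem log_measureReal_le_sum_log_add_binEntropy (hA : ∀ i, MeasurableSet (A i))
    (hQ0 : 0 < (Measure.pi μ).real Q) (hτ : 0 < τ) (hτ2 : τ ≤ 1 / 2)
    (hexc : ∀ i, (Measure.pi μ).real (Q ∩ {x | x i ∉ A i}) ≤ τ * (Measure.pi μ).real Q) :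
    Real.log ((Measure.pi μ).real Q) ≤
      (1 - τ) * ∑ i, Real.log ((μ i).real (A i)) + Fintype.card V * Real.binEntropy τ := by
  set m := (Measure.pi μ).real Q
  have hτ1 : τ < 1 := by linarith
  have hA0 (i) : 0 < (μ i).real (A i) :=
    (mul_pos (sub_pos.2 hτ1) hQ0).trans_le (one_sub_mul_le_measureReal (hA i) (hexc i))
  have hpos (i) (y : X i) := twoLevelDensity_pos hτ hτ1 (hA0 i) y
  have hlog (x : ∀ i, X i) : Real.log (∏ i, twoLevelDensity (μ i) (A i) τ (x i)) =
      ∑ i, Real.log (twoLevelDensity (μ i) (A i) τ (x i)) :=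
    Real.log_prod fun i _ => (hpos i (x i)).ne'
  have hint (i) := integrable_log_twoLevelDensity (hA i) hτ1 (hA0 i)
  have hgibbs : ∫ x in Q, Real.log (∏ i, twoLevelDensity (μ i) (A i) τ (x i)) ∂Measure.pi μ ≤
      m.negMulLog := by
    refine setIntegral_log_le_negMulLog (fun x => Finset.prod_pos fun i _ => hpos i (x i))
      (.fintype_prod_dep fun i => integrable_twoLevelDensity (hA i) τ) ?_ ?_
    · rw [integral_fintype_prod_eq_prod]
      exact Finset.prod_le_one (fun i _ => integral_nonneg fun y => (hpos i y).le)
        fun i _ => integral_twoLevelDensity_le_one hτ.le hτ1.le (hA i)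
    · simp only [hlog]
      exact (integrable_finsetSum _ fun i _ => hint i).integrableOn
  simp only [hlog] at hgibbs
  rw [integral_finsetSum _ fun i _ => (hint i).integrableOn, Real.negMulLog] at hgibbs
  have hcross := (Finset.sum_le_sum fun i _ =>
    le_setIntegral_log_twoLevelDensity (hA i) hτ hτ2 (hA0 i) (hexc i)).trans hgibbs
  rw [← Finset.sum_mul, Finset.sum_neg_distrib, Finset.sum_add_distrib, ← Finset.mul_sum,
    Finset.sum_const, Finset.card_univ, nsmul_eq_mul, mul_comm (-m), neg_mul, mul_neg,
    neg_le_neg_iff] at hcross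
  exact le_of_mul_le_mul_right hcross hQ0

end EntropyBound

section RandomSubsets

variable {V ι : Type*} [DecidableEq V]

theorem card_not_disjoint_union_le (E : Finset ι) (R : ι → Finset V) (S T : Finset V) :
    {f ∈ E | ¬Disjoint (R f) (S ∪ T)}.card ≤
      {f ∈ E | ¬Disjoint (R f) S}.card + {f ∈ E | ¬Disjoint (R f) T}.card := by
  classical
  refine (Finset.card_le_card fun f hf => ?_).trans (Finset.card_union_le _ _)
  simpa only [Finset.mem_union, Finset.mem_filter, Finset.disjoint_union_right, not_and_or,
    and_or_left] using hf

variable [Fintype V]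

/-- The probability that a random subset of `V`, in which each point is put independently with
probability `q`, equals `R`. -/
def randomSubsetWeight (q : ℝ) (R : Finset V) : ℝ :=
  q ^ R.card * (1 - q) ^ Rᶜ.card

theorem randomSubsetWeight_nonneg {q : ℝ} (hq : 0 ≤ q) (hq1 : q ≤ 1) (R : Finset V) :
    0 ≤ randomSubsetWeight q R :=
  mul_nonneg (pow_nonneg hq _) (pow_nonneg (sub_nonneg.2 hq1) _)

theorem sum_randomSubsetWeight_superset (q : ℝ) (T : Finset V) :
    ∑ R : Finset V, randomSubsetWeight q R * (if T ⊆ R then 1 else 0) = q ^ T.card := by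
  have hprod : ∏ v : V, (q + if v ∈ T then 0 else 1 - q) = q ^ T.card := by
    have (v : V) : (q + if v ∈ T then 0 else 1 - q) = if v ∈ T then q else 1 := by
      split_ifs <;> ring
    simp_rw [this]
    simp
  rw [← hprod, Finset.prod_add, Finset.powerset_univ]
  refine Finset.sum_congr rfl fun R _ => ?_
  rw [Finset.prod_const, randomSubsetWeight, mul_assoc, ← Finset.compl_eq_univ_sdiff]
  congr 1
  split_ifs with hTR
  · rw [mul_one, ← Finset.prod_const]
    exact Finset.prod_congr rfl fun v hv => by
      rw [if_neg fun hvT => Finset.mem_compl.1 hv (hTR hvT)]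
  · obtain ⟨v, hvT, hvR⟩ := Finset.not_subset.1 hTR
    rw [mul_zero, eq_comm]
    exact Finset.prod_eq_zero (i := v) (Finset.mem_compl.2 hvR) (if_pos hvT)

theorem sum_randomSubsetWeight (q : ℝ) : ∑ R : Finset V, randomSubsetWeight q R = 1 := by
  simpa using sum_randomSubsetWeight_superset q (∅ : Finset V)

theorem sum_randomSubsetWeight_mul_deviation (q : ℝ) (L L' : Finset V) :
    ∑ R : Finset V, randomSubsetWeight q R *
      (((if L ⊆ R then 1 else 0) - q ^ L.card) * ((if L' ⊆ R then 1 else 0) - q ^ L'.card)) =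
      q ^ (L ∪ L').card - q ^ L.card * q ^ L'.card := by
  have hexpand (R : Finset V) : randomSubsetWeight q R *
      (((if L ⊆ R then 1 else 0) - q ^ L.card) * ((if L' ⊆ R then 1 else 0) - q ^ L'.card)) =
      randomSubsetWeight q R * (if L ∪ L' ⊆ R then 1 else 0) -
        q ^ L'.card * (randomSubsetWeight q R * (if L ⊆ R then 1 else 0)) -
        q ^ L.card * (randomSubsetWeight q R * (if L' ⊆ R then 1 else 0)) +
        q ^ L.card * q ^ L'.card * randomSubsetWeight q R := by
    by_cases h : L ⊆ R <;> by_cases h' : L' ⊆ R <;>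
      simp only [Finset.union_subset_iff, h, h', and_self, and_true, and_false, if_true,
        if_false] <;> ring
  simp_rw [hexpand, Finset.sum_add_distrib, Finset.sum_sub_distrib, ← Finset.mul_sum,
    sum_randomSubsetWeight_superset, sum_randomSubsetWeight]
  ring

theorem sum_randomSubsetWeight_mul_card_not_disjoint_le (E : Finset ι) {R : ι → Finset V}
    {r : ℕ} (hR : ∀ f ∈ E, (R f).card = r) {q : ℝ} (hq : 0 ≤ q) (hq1 : q ≤ 1) :
    ∑ T : Finset V, randomSubsetWeight q T * {f ∈ E | ¬Disjoint (R f) T}.card ≤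
      r * q * E.card := by
  calc ∑ T : Finset V, randomSubsetWeight q T * {f ∈ E | ¬Disjoint (R f) T}.card
      ≤ ∑ T : Finset V, randomSubsetWeight q T *
          ∑ f ∈ E, ∑ i ∈ R f, (if {i} ⊆ T then (1 : ℝ) else 0) := by
        refine Finset.sum_le_sum fun T _ => mul_le_mul_of_nonneg_left ?_
          (randomSubsetWeight_nonneg hq hq1 T)
        rw [Finset.card_filter, Nat.cast_sum]
        refine Finset.sum_le_sum fun f _ => ?_
        have hnonneg : ∀ i ∈ R f, (0 : ℝ) ≤ if {i} ⊆ T then 1 else 0 :=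
          fun i _ => by split_ifs <;> norm_num
        by_cases hdisj : Disjoint (R f) T
        · simpa only [hdisj, not_true_eq_false, if_false, Nat.cast_zero] using
            Finset.sum_nonneg hnonneg
        · obtain ⟨i, hi, hiT⟩ := Finset.not_disjoint_iff.1 hdisj
          refine le_trans ?_ (Finset.single_le_sum hnonneg hi)
          simp [hdisj, hiT]
    _ = ∑ f ∈ E, ∑ i ∈ R f, ∑ T : Finset V, randomSubsetWeight q T *
          (if {i} ⊆ T then (1 : ℝ) else 0) := by
        simp_rw [Finset.mul_sum]
        rw [Finset.sum_comm]
        exact Finset.sum_congr rfl fun _ _ => Finset.sum_comm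
    _ = ∑ _ ∈ E, (r : ℝ) * q :=
        Finset.sum_congr rfl fun f hf => by
          simp only [sum_randomSubsetWeight_superset, Finset.card_singleton, pow_one,
            Finset.sum_const, hR f hf, nsmul_eq_mul]
    _ = r * q * E.card := by rw [Finset.sum_const, nsmul_eq_mul, mul_comm]

end RandomSubsets

section Pinning

variable {V ι : Type*} [DecidableEq V] {F : Finset ι} {v : ι → V} {L : ι → Finset V} {s : ℕ}
  {q C : ℝ}

/-- The number of pairs in `F` of links `L` hanging at the same vertex `v` that are not
disjoint. -/
def overlapCount (F : Finset ι) (v : ι → V) (L : ι → Finset V) : ℕ :=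
  {p ∈ F ×ˢ F | v p.1 = v p.2 ∧ ¬Disjoint (L p.1) (L p.2)}.card

theorem overlapCount_sigma_erase_le (E : Finset ι) {R : ι → Finset V} {r : ℕ}
    (hR : ∀ f ∈ E, (R f).card = r) :
    overlapCount (E.sigma R) (fun x => x.2) (fun x => (R x.1).erase x.2) ≤
      r * {p ∈ E ×ˢ E | 1 < (R p.1 ∩ R p.2).card}.card := by
  set D := {p ∈ E ×ˢ E | 1 < (R p.1 ∩ R p.2).card} with hD
  have hcard : (D.sigma fun p => R p.1).card = r * D.card := by
    rw [Finset.card_sigma, Finset.sum_const_nat (m := r), mul_comm]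
    intro p hp
    exact hR _ (Finset.mem_product.1 (Finset.mem_filter.1 hp).1).1
  rw [overlapCount, ← hcard]
  refine Finset.card_le_card_of_injOn (fun x => ⟨(x.1.1, x.2.1), x.1.2⟩) ?_ ?_
  · rintro ⟨⟨f, i⟩, ⟨g, j⟩⟩ hx
    simp only [Finset.coe_filter, Finset.mem_product, Finset.mem_sigma,
      Set.mem_ofPred_eq] at hx
    obtain ⟨⟨⟨hf, hif⟩, hg, hig⟩, rfl, hmeet⟩ := hx
    obtain ⟨k, hkf, hkg⟩ := Finset.not_disjoint_iff.1 hmeet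
    obtain ⟨hki, hkf⟩ := Finset.mem_erase.1 hkf
    simp only [Finset.coe_sigma, Set.mem_sigma_iff, SetLike.mem_coe, hD, Finset.mem_filter,
      Finset.mem_product]
    exact ⟨⟨⟨hf, hg⟩, Finset.one_lt_card.2
      ⟨k, Finset.mem_inter.2 ⟨hkf, Finset.mem_of_mem_erase hkg⟩,
        i, Finset.mem_inter.2 ⟨hif, hig⟩, hki⟩⟩, hif⟩
  · rintro ⟨⟨f, i⟩, ⟨g, j⟩⟩ hx ⟨⟨f', i'⟩, ⟨g', j'⟩⟩ hx' h
    simp only [Finset.coe_filter, Set.mem_ofPred_eq] at hx hx'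
    simp only [Sigma.mk.injEq, Prod.mk.injEq, heq_eq_eq] at h ⊢
    obtain ⟨⟨rfl, rfl⟩, rfl⟩ := h
    exact ⟨⟨rfl, rfl⟩, rfl, hx.2.1.symm.trans hx'.2.1⟩

theorem exists_subset_sum_union_le [Finite V] {Φ : V → Finset V → ℝ} (h0 : ∀ i S, 0 ≤ Φ i S)
    (h1 : ∀ i S, Φ i S ≤ 1) {t : Finset V → ℝ} (ht0 : t ∅ = 0)
    (htU : ∀ S R, t (S ∪ R) ≤ t S + t R) {l : ℝ} (hl : 0 ≤ l) :
    ∃ S, l * t S ≤ F.card ∧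
      ∀ R, ∑ f ∈ F, Φ (v f) (S ∪ R) ≤ ∑ f ∈ F, Φ (v f) S + l * t R := by
  obtain ⟨S, hS⟩ := Finite.exists_max fun S => ∑ f ∈ F, Φ (v f) S - l * t S
  have hle : ∑ f ∈ F, Φ (v f) S ≤ F.card := by
    simpa using Finset.sum_le_card_nsmul F (fun f => Φ (v f) S) 1 fun f _ => h1 _ _
  have hnonneg : 0 ≤ ∑ f ∈ F, Φ (v f) ∅ := Finset.sum_nonneg fun f _ => h0 _ _
  refine ⟨S, ?_, fun R => ?_⟩
  · have hempty := hS ∅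
    rw [ht0, mul_zero, sub_zero] at hempty
    linarith
  · have hunion := hS (S ∪ R)
    have hcost := mul_le_mul_of_nonneg_left (htU S R) hl
    linarith

variable [Fintype V]

theorem sum_randomSubsetWeight_mul_sum_sq_deviation_le (hL : ∀ f ∈ F, (L f).card = s)
    (hq : 0 ≤ q) (hq1 : q ≤ 1) :
    ∑ R : Finset V, randomSubsetWeight q R *
      ∑ i, (∑ f ∈ F with v f = i, (((if L f ⊆ R then 1 else 0) : ℝ) - q ^ s)) ^ 2 ≤
      overlapCount F v L := by
  have hpairs (R : Finset V) :
      ∑ i, (∑ f ∈ F with v f = i, (((if L f ⊆ R then 1 else 0) : ℝ) - q ^ s)) ^ 2 =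
      ∑ p ∈ F ×ˢ F with v p.1 = v p.2, (((if L p.1 ⊆ R then 1 else 0) : ℝ) - q ^ s) *
        ((if L p.2 ⊆ R then 1 else 0) - q ^ s) := by
    rw [Finset.sum_filter, Finset.sum_product]
    simp_rw [sq, Finset.sum_mul_sum, Finset.sum_filter]
    rw [Finset.sum_comm]
    refine Finset.sum_congr rfl fun f _ => ?_
    rw [Finset.sum_ite_eq, if_pos (Finset.mem_univ _)]
    simp only [eq_comm]
  simp_rw [hpairs, Finset.mul_sum]
  rw [Finset.sum_comm, overlapCount, ← Finset.filter_filter, Finset.card_filter, Nat.cast_sum]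
  refine Finset.sum_le_sum fun p hp => ?_
  obtain ⟨hp1, hp2⟩ := Finset.mem_product.1 (Finset.mem_filter.1 hp).1
  have hcov := sum_randomSubsetWeight_mul_deviation q (L p.1) (L p.2)
  rw [hL _ hp1, hL _ hp2] at hcov
  rw [hcov]
  by_cases hdisj : Disjoint (L p.1) (L p.2)
  · rw [Finset.card_union_of_disjoint hdisj, hL _ hp1, hL _ hp2, pow_add]
    simp [hdisj]
  · have hle : q ^ (L p.1 ∪ L p.2).card ≤ 1 := pow_le_one₀ hq hq1
    have hnonneg : 0 ≤ q ^ s * q ^ s := by positivity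
    simp only [hdisj, not_false_eq_true, if_true, Nat.cast_one]
    linarith

theorem sum_sum_randomSubsetWeight_mul_abs_deviation_le (hL : ∀ f ∈ F, (L f).card = s)
    (hq : 0 ≤ q) (hq1 : q ≤ 1) (hC : 0 ≤ C)
    (hO : (Fintype.card V : ℝ) * overlapCount F v L ≤ C ^ 2) :
    ∑ R : Finset V, ∑ i, randomSubsetWeight q R *
      |∑ f ∈ F with v f = i, (((if L f ⊆ R then 1 else 0) : ℝ) - q ^ s)| ≤ C := by
  set dev : Finset V → V → ℝ := fun R i =>
    ∑ f ∈ F with v f = i, (((if L f ⊆ R then 1 else 0) : ℝ) - q ^ s)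
  have hw := randomSubsetWeight_nonneg (V := V) hq hq1
  have hvar := sum_randomSubsetWeight_mul_sum_sq_deviation_le (v := v) hL hq hq1
  have hcauchy := Finset.sum_mul_sq_le_sq_mul_sq (Finset.univ : Finset (Finset V × V))
    (fun p => √(randomSubsetWeight q p.1)) (fun p => √(randomSubsetWeight q p.1) * |dev p.1 p.2|)
  simp only [← mul_assoc, mul_pow, Real.mul_self_sqrt (hw _), Real.sq_sqrt (hw _), sq_abs,
    Fintype.sum_prod_type] at hcauchy
  have hmass : ∑ R : Finset V, ∑ _i : V, randomSubsetWeight q R = Fintype.card V := by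
    simp [← Finset.mul_sum, sum_randomSubsetWeight]
  simp_rw [Finset.mul_sum] at hvar
  rw [hmass] at hcauchy
  exact (abs_le_of_sq_le_sq' (hcauchy.trans
    ((mul_le_mul_of_nonneg_left hvar (Nat.cast_nonneg _)).trans hO)) hC).2

theorem sum_randomSubsetWeight_mul_sum_deviation_mul_le (hL : ∀ f ∈ F, (L f).card = s)
    (hq : 0 ≤ q) (hq1 : q ≤ 1) (hC : 0 ≤ C)
    (hO : (Fintype.card V : ℝ) * overlapCount F v L ≤ C ^ 2)
    {Ψ : V → Finset V → ℝ} (hΨ : ∀ i R, |Ψ i R| ≤ 1) :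
    ∑ R : Finset V, randomSubsetWeight q R *
      ∑ f ∈ F, ((if L f ⊆ R then 1 else 0) - q ^ s) * Ψ (v f) R ≤ C := by
  refine (Finset.sum_le_sum fun R _ => ?_).trans
    (sum_sum_randomSubsetWeight_mul_abs_deviation_le (v := v) hL hq hq1 hC hO)
  rw [← Finset.mul_sum, ← Finset.sum_fiberwise F v]
  refine mul_le_mul_of_nonneg_left (Finset.sum_le_sum fun i _ => ?_)
    (randomSubsetWeight_nonneg hq hq1 R)
  have hfactor : ∑ f ∈ F with v f = i, ((if L f ⊆ R then 1 else 0) - q ^ s) * Ψ (v f) R =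
      (∑ f ∈ F with v f = i, ((if L f ⊆ R then 1 else 0) - q ^ s)) * Ψ i R := by
    rw [Finset.sum_mul]
    exact Finset.sum_congr rfl fun f hf => by rw [(Finset.mem_filter.1 hf).2]
  rw [hfactor]
  refine (le_abs_self _).trans ?_
  rw [abs_mul]
  exact mul_le_of_le_one_right (abs_nonneg _) (hΨ i R)

theorem pow_mul_sum_link_le (hL : ∀ f ∈ F, (L f).card = s) (hq : 0 ≤ q) (hq1 : q ≤ 1)
    (hC : 0 ≤ C) (hO : (Fintype.card V : ℝ) * overlapCount F v L ≤ C ^ 2)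
    {Ψ : V → Finset V → ℝ} (hmono : ∀ i, Monotone (Ψ i)) (hΨ : ∀ i R, |Ψ i R| ≤ 1) :
    q ^ s * ∑ f ∈ F, Ψ (v f) (L f) ≤
      q ^ s * ∑ R : Finset V, randomSubsetWeight q R * ∑ f ∈ F, Ψ (v f) R + C := by
  have hdev := sum_randomSubsetWeight_mul_sum_deviation_mul_le (v := v) hL hq hq1 hC hO hΨ
  have hlink : q ^ s * ∑ f ∈ F, Ψ (v f) (L f) ≤ ∑ R : Finset V, randomSubsetWeight q R *
      ∑ f ∈ F, (if L f ⊆ R then 1 else 0) * Ψ (v f) R := by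
    calc q ^ s * ∑ f ∈ F, Ψ (v f) (L f)
        = ∑ f ∈ F, ∑ R : Finset V,
            randomSubsetWeight q R * ((if L f ⊆ R then 1 else 0) * Ψ (v f) (L f)) := by
          rw [Finset.mul_sum]
          refine Finset.sum_congr rfl fun f hf => ?_
          simp_rw [← mul_assoc, ← Finset.sum_mul, sum_randomSubsetWeight_superset, hL f hf]
      _ ≤ ∑ f ∈ F, ∑ R : Finset V,
            randomSubsetWeight q R * ((if L f ⊆ R then 1 else 0) * Ψ (v f) R) := by
          refine Finset.sum_le_sum fun f _ => Finset.sum_le_sum fun R _ =>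
            mul_le_mul_of_nonneg_left ?_ (randomSubsetWeight_nonneg hq hq1 R)
          split_ifs with h
          · exact mul_le_mul_of_nonneg_left (hmono _ h) zero_le_one
          · simp only [zero_mul, le_refl]
      _ = _ := by
          rw [Finset.sum_comm]
          simp only [Finset.mul_sum]
  simp only [sub_mul, Finset.sum_sub_distrib, mul_sub, ← Finset.mul_sum,
    mul_left_comm _ (q ^ s)] at hdev
  linarith

/-- The stable set is obtained by adding vertices as long as they pay for their cost: then a
random set does not pay for its cost, and by `pow_mul_sum_link_le` a link behaves like a random
set. -/
theorem exists_stable_set (hL : ∀ f ∈ F, (L f).card = s) {Φ : V → Finset V → ℝ}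
    (hmono : ∀ i, Monotone (Φ i)) (h0 : ∀ i S, 0 ≤ Φ i S) (h1 : ∀ i S, Φ i S ≤ 1)
    {t : Finset V → ℝ} (ht0 : t ∅ = 0) (htU : ∀ S R, t (S ∪ R) ≤ t S + t R)
    {l B : ℝ} (hl : 0 ≤ l) (hq : 0 < q) (hq1 : q ≤ 1)
    (ht : ∑ R, randomSubsetWeight q R * t R ≤ B) (hC : 0 ≤ C)
    (hO : (Fintype.card V : ℝ) * overlapCount F v L ≤ (C * q ^ s) ^ 2) :
    ∃ S, l * t S ≤ F.card ∧
      ∑ f ∈ F, (Φ (v f) (S ∪ L f) - Φ (v f) S) ≤ l * B + C := by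
  obtain ⟨S, hcheap, hmax⟩ := exists_subset_sum_union_le (F := F) (v := v) h0 h1 ht0 htU hl
  refine ⟨S, hcheap, ?_⟩
  have hrandom : ∑ R, randomSubsetWeight q R * ∑ f ∈ F, Φ (v f) (S ∪ R) ≤
      ∑ f ∈ F, Φ (v f) S + l * B := by
    calc ∑ R, randomSubsetWeight q R * ∑ f ∈ F, Φ (v f) (S ∪ R)
        ≤ ∑ R, randomSubsetWeight q R * (∑ f ∈ F, Φ (v f) S + l * t R) :=
          Finset.sum_le_sum fun R _ => mul_le_mul_of_nonneg_left (hmax R)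
            (randomSubsetWeight_nonneg hq.le hq1 R)
      _ = ∑ f ∈ F, Φ (v f) S + l * ∑ R, randomSubsetWeight q R * t R := by
          simp_rw [mul_add, Finset.sum_add_distrib, ← Finset.sum_mul, sum_randomSubsetWeight,
            one_mul, mul_left_comm _ l, ← Finset.mul_sum]
      _ ≤ _ := by gcongr
  have hlink := pow_mul_sum_link_le (v := v) hL hq.le hq1 (by positivity) hO
    (Ψ := fun i R => Φ i (S ∪ R)) (fun i R R' h => hmono i (Finset.union_subset_union_right h))
    fun i R => abs_le.2 ⟨by linarith [h0 i (S ∪ R)], h1 _ _⟩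
  rw [mul_comm C, ← mul_add] at hlink
  have hlink := le_of_mul_le_mul_left hlink (pow_pos hq s)
  rw [Finset.sum_sub_distrib]
  linarith

end Pinning

section Conditioning

variable {V : Type*} [Fintype V] [DecidableEq V] {X : V → Type*} [∀ i, MeasurableSpace (X i)]
  {μ : ∀ i, Measure (X i)} [∀ i, IsProbabilityMeasure (μ i)] {P Q : Set (∀ i, X i)}
  {ι : Type*} {E : Finset ι} {R : ι → Finset V} {F : ι → Set (∀ i, X i)} {r : ℕ}
  {τ η B : ℝ} {S : Finset V}

theorem exists_conditioning_set (hP : MeasurableSet P) (hP0 : 0 < (Measure.pi μ).real P)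
    (hR : ∀ f ∈ E, (R f).card = r) {δ δ' q : ℝ} (hδ : 0 < δ) (hδ' : 0 < δ') (hq : 0 < q)
    (hq1 : q ≤ 1) (hrq : r * q ≤ δ * (δ' / 2))
    (hpairs : (Fintype.card V : ℝ) * (r * {p ∈ E ×ˢ E | 1 < (R p.1 ∩ R p.2).card}.card) ≤
      (δ' / 2 * E.card * q ^ (r - 1)) ^ 2) :
    ∃ S : Finset V, ({f ∈ E | ¬Disjoint (R f) S}.card : ℝ) ≤ r * δ * E.card ∧
      ∑ f ∈ E, ∑ i ∈ R f, (energy μ P i (S ∪ R f) - energy μ P i S) ≤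
        δ' * E.card * (Measure.pi μ).real P := by
  set m := (Measure.pi μ).real P
  obtain ⟨S, hcheap, hstable⟩ := exists_stable_set (F := E.sigma R) (v := fun x => x.2)
    (L := fun x => (R x.1).erase x.2) (s := r - 1) (C := δ' / 2 * E.card)
    (fun x hx => by
      obtain ⟨hf, hi⟩ := Finset.mem_sigma.1 hx
      rw [Finset.card_erase_of_mem hi, hR _ hf])
    (Φ := fun i T => energy μ P i T / m)
    (fun i T T' hTT' => div_le_div_of_nonneg_right (energy_mono hP hTT') hP0.le)
    (fun i T => div_nonneg energy_nonneg hP0.le)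
    (fun i T => div_le_one_of_le₀ (energy_le_measureReal hP) hP0.le)
    (t := fun T => {f ∈ E | ¬Disjoint (R f) T}.card) (by simp)
    (fun S T => by exact_mod_cast card_not_disjoint_union_le E R S T) (inv_pos.2 hδ).le hq hq1
    (sum_randomSubsetWeight_mul_card_not_disjoint_le E hR hq.le hq1) (by positivity)
    (le_trans (by gcongr; exact_mod_cast overlapCount_sigma_erase_le E hR) hpairs)
  refine ⟨S, ?_, ?_⟩
  · rw [Finset.card_sigma, Finset.sum_const_nat hR, inv_mul_le_iff₀ hδ] at hcheap
    push_cast at hcheap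
    linarith
  · rw [Finset.sum_sigma] at hstable
    have hsum : ∑ f ∈ E, ∑ i ∈ R f, (energy μ P i (S ∪ R f) - energy μ P i S) =
        (∑ f ∈ E, ∑ i ∈ R f,
          (energy μ P i (S ∪ (R f).erase i) / m - energy μ P i S / m)) * m := by
      simp only [Finset.sum_mul, ← sub_div, div_mul_cancel₀ _ hP0.ne', energy_union_erase]
    rw [hsum]
    refine mul_le_mul_of_nonneg_right (hstable.trans ?_) hP0.le
    have hcost : δ⁻¹ * (r * q * E.card) ≤ δ' / 2 * E.card := by
      rw [inv_mul_le_iff₀ hδ, ← mul_assoc]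
      gcongr
    linarith

/-- Either the events `F f` have small average probability on the box of likely values of `Q`, and
the entropy bound applies, or the average on the right is already at least the measure of `Q`. -/
theorem measureReal_le_exp_add_average (hQ : MeasurableSet Q) (hτ : 0 < τ) (hτ2 : τ ≤ 1 / 2)
    (hη : 0 < η)
    (hbox : ∀ A : ∀ i, Set (X i), (∀ i, MeasurableSet (A i)) →
      (∑ f ∈ E, (Measure.pi μ).real (F f ∩ (R f : Set V).pi A)) / E.card < η →
        ∏ i, (μ i).real (A i) ≤ Real.exp (-B)) :
    (Measure.pi μ).real Q ≤
      Real.exp (-((1 - τ) * B) + Fintype.card V * Real.binEntropy τ) +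
        (∑ f ∈ E, (Measure.pi μ).real (F f ∩ (R f : Set V).pi (likelyValues μ Q τ)) *
          (Measure.pi μ).real Q) / (E.card * η) := by
  have hA := measurableSet_likelyValues (μ := μ) hQ τ
  have hexc := measureReal_inter_unlikely_le (μ := μ) hQ hτ.le
  set A := likelyValues μ Q τ
  set m := (Measure.pi μ).real Q with hmdef
  rcases (measureReal_nonneg : 0 ≤ m).eq_or_lt with hm | hm
  · rw [← hmdef] at hm
    rw [← hm]
    simp only [mul_zero, Finset.sum_const_zero, zero_div, add_zero]
    positivity
  rcases lt_or_ge ((∑ f ∈ E, (Measure.pi μ).real (F f ∩ (R f : Set V).pi A)) / E.card) η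
    with hfew | hmany
  · refine le_add_of_le_of_nonneg ?_ (by positivity)
    have hA0 (i) : 0 < (μ i).real (A i) :=
      (mul_pos (by linarith) hm).trans_le (one_sub_mul_le_measureReal (hA i) (hexc i))
    have hlog : ∑ i, Real.log ((μ i).real (A i)) ≤ -B := by
      rw [← Real.log_prod fun i _ => (hA0 i).ne',
        Real.log_le_iff_le_exp (Finset.prod_pos fun i _ => hA0 i)]
      exact hbox A hA hfew
    rw [← Real.log_le_iff_le_exp hm]
    refine (log_measureReal_le_sum_log_add_binEntropy hA hm hτ hτ2 hexc).trans ?_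
    nlinarith
  · refine le_add_of_nonneg_of_le (Real.exp_pos _).le ?_
    rw [← Finset.sum_mul, mul_div_right_comm, ← div_div]
    exact le_mul_of_one_le_left hm.le ((one_le_div hη).2 hmany)

/-- A bound for the measure of the part of the box of likely values of the slice of `P` at `z` on
which an event depending on the coordinates in `T` occurs, times the measure of the slice. It is
useful only if none of these coordinates is fixed by the slice. -/
noncomputable def conditioningLoss (μ : ∀ i, Measure (X i)) (P : Set (∀ i, X i)) (τ : ℝ)
    (S T : Finset V) (z : ∀ i, X i) : ℝ :=
  if Disjoint T S then (4 / τ) ^ T.card * (24 / τ ^ 2) *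
    ∑ i ∈ T, (energy μ (slice P S z) i T - energy μ (slice P S z) i ∅)
  else marginalDensity μ P S z

theorem measureReal_inter_pi_likelyValues_slice_mul_le {G : Set (∀ i, X i)} {T : Finset V}
    (hP : MeasurableSet P) (hG : DependsOn (· ∈ G) (T : Set V)) (hGP : Disjoint G P) (hτ : 0 < τ)
    (hτ1 : τ ≤ 1) (z : ∀ i, X i) :
    (Measure.pi μ).real (G ∩ (T : Set V).pi (likelyValues μ (slice P S z) τ)) *
      (Measure.pi μ).real (slice P S z) ≤ conditioningLoss μ P τ S T z := by
  rw [conditioningLoss]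
  split_ifs with hTS
  · exact measureReal_inter_pi_likelyValues_mul_le (measurableSet_slice hP S z) hG
      (disjoint_slice hG hTS hGP z) hτ hτ1
  · exact mul_le_of_le_one_left measureReal_nonneg measureReal_le_one

theorem integrable_conditioningLoss (hP : MeasurableSet P) (τ : ℝ) (S T : Finset V) :
    Integrable (conditioningLoss μ P τ S T) (Measure.pi μ) := by
  unfold conditioningLoss
  split_ifs with hTS
  · exact (integrable_finsetSum _ fun i hi =>
      have hiS := Finset.disjoint_left.1 hTS hi
      (integrable_energy_slice hP hiS T).sub (integrable_energy_slice hP hiS ∅)).const_mul _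
  · exact integrable_marginalDensity hP S

theorem integral_conditioningLoss_le (hP : MeasurableSet P) (hτ : 0 ≤ τ) (S T : Finset V) :
    ∫ z, conditioningLoss μ P τ S T z ∂Measure.pi μ ≤
      (4 / τ) ^ T.card * (24 / τ ^ 2) * ∑ i ∈ T, (energy μ P i (S ∪ T) - energy μ P i S) +
        (if Disjoint T S then 0 else (Measure.pi μ).real P) := by
  unfold conditioningLoss
  split_ifs with hTS
  · rw [add_zero, integral_const_mul, integral_finsetSum]
    · refine le_of_eq (congrArg _ (Finset.sum_congr rfl fun i hi => ?_))
      have hiS := Finset.disjoint_left.1 hTS hi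
      rw [integral_sub (integrable_energy_slice hP hiS T) (integrable_energy_slice hP hiS ∅),
        integral_energy_slice hP hiS, integral_energy_slice hP hiS, Finset.union_empty]
    · intro i hi
      have hiS := Finset.disjoint_left.1 hTS hi
      exact (integrable_energy_slice hP hiS T).sub (integrable_energy_slice hP hiS ∅)
  · rw [integral_marginalDensity hP S]
    exact le_add_of_nonneg_left (mul_nonneg (by positivity) (Finset.sum_nonneg fun i _ =>
      sub_nonneg.2 (energy_mono hP Finset.subset_union_left)))

theorem measureReal_le_two_mul_exp (hP : MeasurableSet P)
    (hF : ∀ f ∈ E, DependsOn (· ∈ F f) (R f : Set V)) (hFP : ∀ f ∈ E, Disjoint (F f) P)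
    (hR : ∀ f ∈ E, (R f).card = r) (hτ : 0 < τ) (hτ2 : τ ≤ 1 / 2) (hη : 0 < η)
    (hbox : ∀ A : ∀ i, Set (X i), (∀ i, MeasurableSet (A i)) →
      (∑ f ∈ E, (Measure.pi μ).real (F f ∩ (R f : Set V).pi A)) / E.card < η →
        ∏ i, (μ i).real (A i) ≤ Real.exp (-B))
    (htouch : ({f ∈ E | ¬Disjoint (R f) S}.card : ℝ) ≤ η / 4 * E.card)
    (hstable : (4 / τ) ^ r * (24 / τ ^ 2) *
      ∑ f ∈ E, ∑ i ∈ R f, (energy μ P i (S ∪ R f) - energy μ P i S) ≤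
        η / 4 * E.card * (Measure.pi μ).real P) :
    (Measure.pi μ).real P ≤
      2 * Real.exp (-((1 - τ) * B) + Fintype.card V * Real.binEntropy τ) := by
  set M := Real.exp (-((1 - τ) * B) + Fintype.card V * Real.binEntropy τ)
  set m := (Measure.pi μ).real P with hmdef
  have hm : 0 ≤ m := measureReal_nonneg
  have hslice (z) : marginalDensity μ P S z ≤
      M + (∑ f ∈ E, conditioningLoss μ P τ S (R f) z) / (E.card * η) := by
    refine (measureReal_le_exp_add_average (F := F) (R := R) (measurableSet_slice hP S z) hτ hτ2
      hη hbox).trans ?_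
    gcongr with f hf
    exact measureReal_inter_pi_likelyValues_slice_mul_le hP (hF f hf) (hFP f hf) hτ (by linarith) z
  have hloss (f) := integrable_conditioningLoss (μ := μ) hP τ S (R f)
  have hlosses : ∑ f ∈ E, ∫ z, conditioningLoss μ P τ S (R f) z ∂Measure.pi μ ≤
      m / 2 * (E.card * η) := by
    calc ∑ f ∈ E, ∫ z, conditioningLoss μ P τ S (R f) z ∂Measure.pi μ
        ≤ ∑ f ∈ E, ((4 / τ) ^ r * (24 / τ ^ 2) *
            ∑ i ∈ R f, (energy μ P i (S ∪ R f) - energy μ P i S) +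
            (if ¬Disjoint (R f) S then m else 0)) := by
          refine Finset.sum_le_sum fun f hf => ?_
          rw [← hR f hf, ite_not]
          exact integral_conditioningLoss_le hP hτ.le S (R f)
      _ = (4 / τ) ^ r * (24 / τ ^ 2) *
            ∑ f ∈ E, ∑ i ∈ R f, (energy μ P i (S ∪ R f) - energy μ P i S) +
          {f ∈ E | ¬Disjoint (R f) S}.card * m := by
          rw [Finset.sum_add_distrib, ← Finset.mul_sum, ← Finset.sum_filter, Finset.sum_const,
            nsmul_eq_mul]
      _ ≤ η / 4 * E.card * m + η / 4 * E.card * m := by gcongr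
      _ = m / 2 * (E.card * η) := by ring
  have hintegrated : m ≤ M + m / 2 := by
    calc m = ∫ z, marginalDensity μ P S z ∂Measure.pi μ := (integral_marginalDensity hP S).symm
      _ ≤ ∫ z, (M + (∑ f ∈ E, conditioningLoss μ P τ S (R f) z) / (E.card * η)) ∂Measure.pi μ :=
          integral_mono (integrable_marginalDensity hP S)
            ((integrable_const M).add ((integrable_finsetSum _ fun f _ => hloss f).div_const _))
            hslice
      _ = M + (∑ f ∈ E, ∫ z, conditioningLoss μ P τ S (R f) z ∂Measure.pi μ) / (E.card * η) := by
          rw [integral_add (integrable_const M)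
            ((integrable_finsetSum _ fun f _ => hloss f).div_const _), integral_div,
            integral_finsetSum _ fun f _ => hloss f, integral_const, probReal_univ, one_smul]
      _ ≤ M + m / 2 := by
          exact add_le_add_right
            (div_le_of_le_mul₀ (by positivity) (by positivity) hlosses) M
  linarith

end Conditioning

section Embeddings

variable {V W : Type*} [Fintype W]

theorem card_filter_map_subset_le [DecidableEq V] (E : Finset (W ↪ V)) (T : Finset V) :
    {ψ ∈ E | Finset.univ.map ψ ⊆ T}.card ≤ T.card ^ Fintype.card W := by
  classical
  calc {ψ ∈ E | Finset.univ.map ψ ⊆ T}.card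
      ≤ (Fintype.piFinset fun _ : W => T).card :=
        Finset.card_le_card_of_injOn (fun ψ : W ↪ V => (ψ : W → V))
          (fun ψ hψ => Fintype.mem_piFinset.2 fun k =>
            (Finset.mem_filter.1 hψ).2 (Finset.mem_map_of_mem ψ (Finset.mem_univ k)))
          DFunLike.coe_injective.injOn
    _ = T.card ^ Fintype.card W := by
        rw [Fintype.card_piFinset, Finset.prod_const, Finset.card_univ]

theorem card_pairs_map_subset_le [DecidableEq V] (E : Finset (W ↪ V)) :
    {p ∈ E ×ˢ E | Finset.univ.map p.2 ⊆ Finset.univ.map p.1}.card ≤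
      Fintype.card W ^ Fintype.card W * E.card := by
  rw [Finset.card_filter, Finset.sum_product, mul_comm, ← smul_eq_mul]
  refine Finset.sum_le_card_nsmul _ _ _ fun φ _ => ?_
  rw [← Finset.card_filter]
  refine (card_filter_map_subset_le E (Finset.univ.map φ)).trans_eq ?_
  rw [Finset.card_map, Finset.card_univ]

theorem dependsOn_comp_mem {Y : Type*} (φ : W ↪ V) (Q : Set (W → Y)) :
    DependsOn (· ∈ {x : V → Y | x ∘ φ ∈ Q}) (Finset.univ.map φ : Set V) := by
  intro x y hxy
  have hcomp : x ∘ φ = y ∘ φ := funext fun k => hxy _ (by simp)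
  simp only [Set.mem_ofPred_eq, hcomp]

theorem measurePreserving_comp_embedding [Fintype V] {Y : Type*} [MeasurableSpace Y]
    (ν : Measure Y) [IsProbabilityMeasure ν] (φ : W ↪ V) :
    MeasurePreserving (fun x : V → Y => x ∘ φ) (Measure.pi fun _ => ν)
      (Measure.pi fun _ => ν) := by
  have hmeas : Measurable fun x : V → Y => x ∘ φ := by fun_prop
  refine ⟨hmeas, (Measure.pi_eq fun s hs => ?_).symm⟩
  have hpreimage : (fun x : V → Y => x ∘ φ) ⁻¹' Set.univ.pi s =
      Set.univ.pi (Function.extend φ s fun _ => Set.univ) := by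
    ext x
    simp only [Set.mem_preimage, Set.mem_univ_pi, Function.comp_apply]
    refine ⟨fun h i => ?_, fun h k => by simpa [φ.injective.extend_apply] using h (φ k)⟩
    by_cases hi : ∃ k, φ k = i
    · obtain ⟨k, rfl⟩ := hi
      rw [φ.injective.extend_apply]
      exact h k
    · rw [Function.extend_apply' _ _ _ hi]
      trivial
  rw [Measure.map_apply hmeas (MeasurableSet.univ_pi hs), hpreimage, Measure.pi_pi]
  refine (Fintype.prod_of_injective φ φ.injective _ _ (fun i hi => ?_) fun k => ?_).symm
  · rw [Function.extend_apply' _ _ _ hi, measure_univ]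
  · rw [φ.injective.extend_apply]

end Embeddings

section Entropy

variable {V : Type u} [Fintype V] {b Q : Set (Decoration V)} {c : ℝ}

theorem entropy_eq_neg_log (hb : 0 < volume.real b) :
    entropy b = ((-Real.log (volume.real b) : ℝ) : EReal) := by
  rw [entropy, ENNReal.log_pos_real' hb]
  rfl

theorem volume_le_exp_of_lt_entropy (h : (c : EReal) < entropy b) :
    volume.real b ≤ Real.exp (-c) := by
  rcases (measureReal_nonneg (μ := volume) (s := b)).eq_or_lt with hb | hb
  · rw [← hb]
    exact (Real.exp_pos _).le
  · rw [entropy_eq_neg_log hb, EReal.coe_lt_coe_iff] at h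
    rw [← Real.log_le_iff_le_exp hb]
    linarith

theorem exp_lt_volume_of_entropy_lt (h : entropy b < (c : EReal)) :
    Real.exp (-c) < volume.real b := by
  have hb : 0 < volume.real b := by
    refine measureReal_nonneg.lt_of_ne' fun hb => ?_
    rw [measureReal_eq_zero_iff] at hb
    simp [entropy, hb] at h
  rw [entropy_eq_neg_log hb, EReal.coe_lt_coe_iff] at h
  rw [← Real.lt_log_iff_exp_lt hb]
  linarith

theorem exp_lt_volume_of_extremalEntropy_lt (h : extremalEntropy Q < (c : EReal)) :
    Real.exp (-c) < volume.real Q := by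
  obtain ⟨_, ⟨b, -, hb, rfl⟩, hlt⟩ := sInf_lt_iff.1 h
  refine (exp_lt_volume_of_entropy_lt hlt).trans_le ?_
  exact ENNReal.toReal_mono (measure_ne_top _ _) (measure_mono_ae (ae_le_set.2 hb))

end Entropy

section Projections

theorem projection_box_subset {W V : Type u} [Fintype V] (φ : W ↪ V)
    (A : V → Set unitInterval) :
    projection φ {c : Decoration V | ∀ i, c i ∈ A i} ⊆ Set.univ.pi fun k => A (φ k) := by
  intro c hc k _
  obtain ⟨-, ⟨x, ⟨hx, hxc⟩, -⟩⟩ := nonempty_of_measure_ne_zero (ne_of_gt hc)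
  rw [← hxc k]
  exact hx (φ k)

theorem volume_projection_box_diff_le {W V : Type u} [Fintype W] [Fintype V] (φ : W ↪ V)
    {A : V → Set unitInterval} (hA : ∀ i, MeasurableSet (A i)) {Q : Set (Decoration W)}
    (hQ : MeasurableSet Q) :
    volume.real (projection φ {c : Decoration V | ∀ i, c i ∈ A i} \ Q) ≤
      volume.real ({x : Decoration V | x ∘ φ ∈ Qᶜ} ∩ (Finset.univ.map φ : Set V).pi A) := by
  have hbox : MeasurableSet (Set.univ.pi fun k => A (φ k)) :=
    MeasurableSet.univ_pi fun k => hA (φ k)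
  calc volume.real (projection φ {c : Decoration V | ∀ i, c i ∈ A i} \ Q)
      ≤ volume.real ((Set.univ.pi fun k => A (φ k)) \ Q) :=
        measureReal_mono (Set.sdiff_subset_sdiff_left (projection_box_subset φ A))
    _ = volume.real ((fun x : Decoration V => x ∘ φ) ⁻¹'
          ((Set.univ.pi fun k => A (φ k)) \ Q)) :=
        ((measurePreserving_comp_embedding volume φ).measureReal_preimage
          (hbox.diff hQ).nullMeasurableSet).symm
    _ ≤ volume.real ({x : Decoration V | x ∘ φ ∈ Qᶜ} ∩ (Finset.univ.map φ : Set V).pi A) :=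
        measureReal_mono fun x hx => ⟨hx.2, by simpa [Set.mem_pi] using hx.1⟩

variable {S : SSEE.{u}} {N n : ℕ} {Q : Set (Decoration (S.V N))} {η c : ℝ}

theorem prod_volume_le_exp_of_forall_box (hQ : MeasurableSet Q)
    (hbox : ∀ b : Set (Decoration (S.V n)), IsBox b → expectedExcess S N n b Q < η →
      (c : EReal) < entropy b)
    {A : S.V n → Set unitInterval} (hA : ∀ i, MeasurableSet (A i))
    (havg : (∑ φ ∈ S.emb N n, volume.real ({x : Decoration (S.V n) | x ∘ φ ∈ Qᶜ} ∩
      (Finset.univ.map φ : Set (S.V n)).pi A)) / (S.emb N n).card < η) :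
    ∏ i, volume.real (A i) ≤ Real.exp (-c) := by
  have hvolume : volume.real {x : Decoration (S.V n) | ∀ i, x i ∈ A i} =
      ∏ i, volume.real (A i) := by
    have hpi : {x : Decoration (S.V n) | ∀ i, x i ∈ A i} = Set.univ.pi A := by
      ext x
      simp only [Set.mem_ofPred_eq, Set.mem_univ_pi]
    simp only [hpi, measureReal_def, volume_pi_pi, ENNReal.toReal_prod]
  rw [← hvolume]
  refine volume_le_exp_of_lt_entropy (hbox _ ⟨A, hA, rfl⟩ (lt_of_le_of_lt ?_ havg))
  unfold expectedExcess
  gcongr with φ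
  exact volume_projection_box_diff_le φ hA hQ

theorem DecorationProperty.IsHereditary.disjoint {P : DecorationProperty S} (hP : P.IsHereditary)
    (hNn : N ≤ n) {φ : S.V N ↪ S.V n} (hφ : φ ∈ S.emb N n) :
    Disjoint {x : Decoration (S.V n) | x ∘ φ ∈ (P.body N)ᶜ} (P.body n) :=
  Set.disjoint_left.2 fun _ hx =>
    hP N n hNn (Set.mem_iUnion₂.2 ⟨φ, hφ, _, hx, fun _ => rfl⟩)

end Projections

namespace SSEE

open Classical in
theorem intersectingCount_eq_card (S : SSEE.{u}) (i N n : ℕ) :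
    S.intersectingCount i N N n = {p ∈ S.emb N n ×ˢ S.emb N n |
      (Finset.univ.map p.1 ∩ Finset.univ.map p.2).card = i}.card := by
  rw [intersectingCount, ← Set.ncard_coe_finset]
  congr 1
  ext p
  simp [← Set.ncard_coe_finset, and_assoc]

open Classical in
theorem card_intersecting_pairs_le (S : SSEE.{u}) (N n : ℕ) :
    {p ∈ S.emb N n ×ˢ S.emb N n |
        1 < (Finset.univ.map p.1 ∩ Finset.univ.map p.2).card}.card ≤
      S.intersectingSum N n +
        Fintype.card (S.V N) ^ Fintype.card (S.V N) * (S.emb N n).card := by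
  set r := Fintype.card (S.V N)
  have hcard (φ : S.V N ↪ S.V n) : (Finset.univ.map φ).card = r := by
    rw [Finset.card_map, Finset.card_univ]
  have hsplit : {p ∈ S.emb N n ×ˢ S.emb N n |
        1 < (Finset.univ.map p.1 ∩ Finset.univ.map p.2).card} ⊆
      (Finset.Ioo 1 r).biUnion (fun i => {p ∈ S.emb N n ×ˢ S.emb N n |
        (Finset.univ.map p.1 ∩ Finset.univ.map p.2).card = i}) ∪
      {p ∈ S.emb N n ×ˢ S.emb N n | Finset.univ.map p.2 ⊆ Finset.univ.map p.1} := by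
    intro p hp
    obtain ⟨hpE, hp1⟩ := Finset.mem_filter.1 hp
    have hle := Finset.card_le_card (Finset.inter_subset_right
      (s₁ := Finset.univ.map p.1) (s₂ := Finset.univ.map p.2))
    rcases hle.eq_or_lt with heq | hlt
    · exact Finset.mem_union_right _ (Finset.mem_filter.2
        ⟨hpE, Finset.inter_eq_right.1 (Finset.eq_of_subset_of_card_le
          Finset.inter_subset_right heq.ge)⟩)
    · exact Finset.mem_union_left _ (Finset.mem_biUnion.2
        ⟨_, Finset.mem_Ioo.2 ⟨hp1, hcard p.2 ▸ hlt⟩, Finset.mem_filter.2 ⟨hpE, rfl⟩⟩)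
  refine (Finset.card_le_card hsplit).trans ((Finset.card_union_le _ _).trans ?_)
  refine add_le_add (Finset.card_biUnion_le.trans_eq ?_) (card_pairs_map_subset_le _)
  exact Finset.sum_congr rfl fun i _ => (S.intersectingCount_eq_card i N n).symm

namespace IsGood

variable {S : SSEE.{u}}

open Classical in
theorem eventually_card_intersecting_pairs_le (hS : S.IsGood) (N : ℕ) {c : ℝ} (hc : 0 < c) :
    ∀ᶠ n in atTop, (Fintype.card (S.V n) : ℝ) *
      {p ∈ S.emb N n ×ˢ S.emb N n |
        1 < (Finset.univ.map p.1 ∩ Finset.univ.map p.2).card}.card ≤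
        c * ((S.emb N n).card : ℝ) ^ 2 := by
  set r := Fintype.card (S.V N)
  rcases le_or_gt r 1 with hr | hr
  · refine Eventually.of_forall fun n => ?_
    rw [Finset.filter_false_of_mem fun p _ => ?_]
    · simp only [Finset.card_empty, Nat.cast_zero, mul_zero]
      positivity
    · exact not_lt.2 (((Finset.card_le_card Finset.inter_subset_left).trans_eq
        (Finset.card_map _)).trans hr)
  have hlimit : Tendsto (fun n => ((Fintype.card (S.V n) : ℝ) * (S.intersectingSum N n : ℝ)) /
      ((S.emb N n).card : ℝ) ^ 2 +
      (r : ℝ) ^ r * (((S.emb N n).card : ℝ) / (Fintype.card (S.V n) : ℝ))⁻¹) atTop (𝓝 0) := by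
    simpa using (hS.few_intersecting N hr).add
      ((hS.many_embeddings N hr).inv_tendsto_atTop.const_mul ((r : ℝ) ^ r))
  filter_upwards [hlimit.eventually_le_const hc,
    (hS.many_embeddings N hr).eventually_gt_atTop 0] with n hn hpos
  have hE : ((S.emb N n).card : ℝ) ≠ 0 := fun h => by simp [h] at hpos
  calc (Fintype.card (S.V n) : ℝ) * {p ∈ S.emb N n ×ˢ S.emb N n |
        1 < (Finset.univ.map p.1 ∩ Finset.univ.map p.2).card}.card
      ≤ Fintype.card (S.V n) * (S.intersectingSum N n + (r : ℝ) ^ r * (S.emb N n).card) := by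
        gcongr
        exact_mod_cast S.card_intersecting_pairs_le N n
    _ = _ * ((S.emb N n).card : ℝ) ^ 2 := by
        rw [inv_div]
        field_simp
    _ ≤ c * ((S.emb N n).card : ℝ) ^ 2 := mul_le_mul_of_nonneg_right hn (by positivity)

open Classical in
theorem eventually_exists_conditioning_set (hS : S.IsGood) (N : ℕ)
    {P : ∀ n, Set (Decoration (S.V n))} (hP : ∀ n, MeasurableSet (P n)) {δ δ' : ℝ}
    (hδ : 0 < δ) (hδ' : 0 < δ') :
    ∀ᶠ n in atTop, 0 < volume.real (P n) → ∃ T : Finset (S.V n),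
      ({φ ∈ S.emb N n | ¬Disjoint (Finset.univ.map φ) T}.card : ℝ) ≤ δ * (S.emb N n).card ∧
      ∑ φ ∈ S.emb N n, ∑ i ∈ Finset.univ.map φ,
        (energy (fun _ => volume) (P n) i (T ∪ Finset.univ.map φ) -
          energy (fun _ => volume) (P n) i T) ≤
        δ' * (S.emb N n).card * volume.real (P n) := by
  set r := Fintype.card (S.V N)
  set δ₁ : ℝ := δ / (r + 1)
  set q : ℝ := min 1 (δ₁ * (δ' / 2) / (r + 1))
  have hδ₁ : 0 < δ₁ := by positivity
  have hq : 0 < q := lt_min one_pos (by positivity)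
  have hrδ : r * δ₁ ≤ δ := by
    rw [← mul_div_assoc, div_le_iff₀ (by positivity)]
    nlinarith
  have hrq : r * q ≤ δ₁ * (δ' / 2) := by
    have hq' : q * (r + 1) ≤ δ₁ * (δ' / 2) :=
      (le_div_iff₀ (by positivity)).1 (min_le_right _ _)
    nlinarith
  filter_upwards [hS.eventually_card_intersecting_pairs_le N
    (c := (δ' / 2 * q ^ (r - 1)) ^ 2 / (r + 1)) (by positivity)] with n hn hpos
  obtain ⟨T, htouch, hstable⟩ := exists_conditioning_set (μ := fun _ => volume)
    (E := S.emb N n) (R := fun φ => Finset.univ.map φ) (hP n) hpos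
    (fun φ _ => (Finset.card_map φ).trans Finset.card_univ) hδ₁ hδ' hq (min_le_left _ _) hrq (by
      rw [div_mul_eq_mul_div, le_div_iff₀ (by positivity)] at hn
      have hcount : (0 : ℝ) ≤ Fintype.card (S.V n) * {p ∈ S.emb N n ×ˢ S.emb N n |
        1 < (Finset.univ.map p.1 ∩ Finset.univ.map p.2).card}.card := by positivity
      linarith)
  exact ⟨T, htouch.trans (by gcongr), hstable⟩

end IsGood

end SSEE

theorem exists_threshold (γ : ℝ) {ε : ℝ} (hε : 0 < ε) :
    ∃ τ : ℝ, 0 < τ ∧ τ ≤ 1 / 2 ∧ τ * γ + Real.binEntropy τ < ε := by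
  have hcont : Continuous fun τ : ℝ => τ * γ + Real.binEntropy τ := by fun_prop
  have hsmall : ∀ᶠ τ : ℝ in 𝓝[>] 0, τ * γ + Real.binEntropy τ < ε ∧ τ < 1 / 2 :=
    nhdsWithin_le_nhds (((hcont.tendsto 0).eventually_lt_const (by simpa using hε)).and
      (eventually_lt_nhds (by norm_num)))
  obtain ⟨τ, ⟨hτε, hτ2⟩, hτ⟩ := (hsmall.and self_mem_nhdsWithin).exists
  exact ⟨τ, hτ, hτ2.le, hτε⟩

theorem SSEE.IsGood.eventually_volume_le {S : SSEE.{u}} (hS : S.IsGood)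
    {P : DecorationProperty S} (hP : P.IsHereditary) {γ ε : ℝ} (hε : 0 < ε)
    {η : ℝ} (hη : 0 < η) {N n₀ : ℕ} (hN : N ≤ n₀)
    (hbox : ∀ n, n₀ ≤ n → ∀ b : Set (Decoration (S.V n)), IsBox b →
      expectedExcess S N n b (P.body N) < η →
        ((γ * (Fintype.card (S.V n) : ℝ) : ℝ) : EReal) < entropy b) :
    ∀ᶠ n in atTop,
      volume.real (P.body n) ≤ Real.exp (-((γ - ε) * (Fintype.card (S.V n) : ℝ))) := by
  classical
  obtain ⟨τ, hτ, hτ2, hτε⟩ := exists_threshold γ (half_pos hε)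
  set K := (4 / τ) ^ Fintype.card (S.V N) * (24 / τ ^ 2)
  have hK0 : 0 < K := by positivity
  have hlarge : ∀ᶠ n in atTop, Real.log 2 ≤ ε / 2 * (Fintype.card (S.V n) : ℝ) :=
    ((tendsto_natCast_atTop_atTop.comp hS.card_tendsto).const_mul_atTop
      (half_pos hε)).eventually_ge_atTop _
  filter_upwards [hS.eventually_exists_conditioning_set N P.measurableSet_body
    (δ := η / 4) (δ' := η / (4 * K)) (by positivity) (by positivity), hlarge,
    eventually_ge_atTop n₀] with n hT hlog hn
  rcases (measureReal_nonneg (μ := volume) (s := P.body n)).eq_or_lt with hnull | hpos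
  · rw [← hnull]
    positivity
  obtain ⟨T, htouch, hstable⟩ := hT hpos
  set m : ℝ := (Fintype.card (S.V n) : ℝ)
  have hbound : volume.real (P.body n) ≤
      2 * Real.exp (-((1 - τ) * (γ * m)) + m * Real.binEntropy τ) :=
    measureReal_le_two_mul_exp (P.measurableSet_body n)
      (fun φ _ => dependsOn_comp_mem φ (P.body N)ᶜ) (fun φ hφ => hP.disjoint (hN.trans hn) hφ)
      (fun φ _ => (Finset.card_map φ).trans Finset.card_univ) hτ hτ2 hη
      (fun A hA => prod_volume_le_exp_of_forall_box (P.measurableSet_body N) (hbox n hn) hA)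
      htouch ((mul_le_mul_of_nonneg_left hstable hK0.le).trans_eq (by field_simp; rfl))
  refine hbound.trans ?_
  rw [← Real.exp_log (zero_lt_two' ℝ), ← Real.exp_add]
  have hloss : m * (τ * γ + Real.binEntropy τ) ≤ m * (ε / 2) :=
    mul_le_mul_of_nonneg_left hτε.le (Nat.cast_nonneg _)
  exact Real.exp_le_exp.2 (by linarith)

theorem eventually_exp_lt_volume {S : SSEE.{u}}
    (hS : Tendsto (fun n => Fintype.card (S.V n)) atTop atTop)
    {P : ∀ n, Set (Decoration (S.V n))} {π : ℝ}
    (hlim : Tendsto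
      (fun n => extremalEntropy (P n) / ((Fintype.card (S.V n) : ℝ) : EReal))
      atTop (𝓝 (π : EReal))) {ε : ℝ} (hε : 0 < ε) :
    ∀ᶠ n in atTop,
      Real.exp (-((π + ε) * (Fintype.card (S.V n) : ℝ))) < volume.real (P n) := by
  have hπε : (π : EReal) < ((π + ε : ℝ) : EReal) := EReal.coe_lt_coe_iff.2 (by linarith)
  filter_upwards [hlim.eventually_lt_const hπε, hS.eventually_gt_atTop 0]
    with n hn hcard
  rw [EReal.div_lt_iff (EReal.coe_pos.2 (Nat.cast_pos.2 hcard)) (EReal.coe_ne_top _),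
    ← EReal.coe_mul] at hn
  exact exp_lt_volume_of_extremalEntropy_lt hn

theorem exists_tendsto_zero_eq_exp {v m : ℕ → ℝ} {π : ℝ} (hm : ∀ᶠ n in atTop, 0 < m n)
    (hlower : ∀ ε > 0, ∀ᶠ n in atTop, Real.exp (-((π + ε) * m n)) < v n)
    (hupper : ∀ ε > 0, ∀ᶠ n in atTop, v n ≤ Real.exp (-((π - ε) * m n))) :
    ∃ o : ℕ → ℝ, Tendsto o atTop (𝓝 0) ∧
      ∀ᶠ n in atTop, v n = Real.exp (-((π + o n) * m n)) := by
  refine ⟨fun n => -Real.log (v n) / m n - π, ?_, ?_⟩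
  · refine Metric.tendsto_nhds.2 fun ε hε => ?_
    filter_upwards [hlower (ε / 2) (half_pos hε), hupper (ε / 2) (half_pos hε), hm]
      with n hl hu hmn
    have hv : 0 < v n := (Real.exp_pos _).trans hl
    have hlog_lower := (Real.lt_log_iff_exp_lt hv).2 hl
    have hlog_upper := (Real.log_le_iff_le_exp hv).2 hu
    rw [Real.dist_eq, sub_zero, abs_lt, lt_sub_iff_add_lt, sub_lt_iff_lt_add,
      lt_div_iff₀ hmn, div_lt_iff₀ hmn]
    constructor <;> nlinarith [mul_pos hε hmn]
  · filter_upwards [hlower 1 one_pos, hm] with n hl hmn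
    rw [add_sub_cancel, div_mul_cancel₀ _ hmn.ne', neg_neg,
      Real.exp_log ((Real.exp_pos _).trans hl)]

theorem mainTheorem5 (S : SSEE.{u}) (hS : S.IsGood)
    (P : DecorationProperty S) (hP : P.IsHereditary)
    (π : ℝ)
    (hlim : Tendsto
      (fun n => extremalEntropy (P.body n) / ((Fintype.card (S.V n) : ℝ) : EReal))
      atTop (𝓝 (π : EReal)))
    (hsat : ∀ ε : ℝ, 0 < ε → ∃ η : ℝ, 0 < η ∧ ∃ N n₀ : ℕ, 0 < N ∧ N ≤ n₀ ∧
      ∀ n, n₀ ≤ n → ∀ b : Set (Decoration (S.V n)), IsBox b →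
        expectedExcess S N n b (P.body N) < η →
          (((π - ε) * (Fintype.card (S.V n) : ℝ) : ℝ) : EReal) < entropy b) :
    ∃ o : ℕ → ℝ, Tendsto o atTop (𝓝 0) ∧ ∀ᶠ n in atTop,
      (volume (P.body n)).toReal =
        Real.exp (-((π + o n) * (Fintype.card (S.V n) : ℝ))) := by
  refine exists_tendsto_zero_eq_exp (v := fun n => volume.real (P.body n))
    ((hS.card_tendsto.eventually_gt_atTop 0).mono fun n hn => Nat.cast_pos.2 hn)
    (fun ε hε => eventually_exp_lt_volume hS.card_tendsto hlim hε) fun ε hε => ?_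
  obtain ⟨η, hη, N, n₀, -, hN, hbox⟩ := hsat (ε / 2) (half_pos hε)
  simpa only [sub_sub, add_halves] using
    hS.eventually_volume_le hP (half_pos hε) hη hN hbox
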